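/- **Setting.** Let $d,r\in\mathbb N=\{1,2,\dots\}$, let $\lambda\ge 2$ be an integer and let $m\ge 0$ be an integer. Write $l_0^{s\times t}$ for the space of finitely supported sequences (filters) $u:\mathbb Z^d\to\mathbb C^{s\times t}$, $\widehat u(\xi)=\sum_k u(k)e^{-ik\cdot\xi}$, $[v*w](k)=\sum_z v(z)w(k-z)$, $\delta$ for the Kronecker sequence and function, $e_1,\dots,e_r$ for the standard basis of $\mathbb C^r$, and $\nabla^\mu=\prod_i\nabla_i^{\mu_i}$, where $\nabla_i v=v-v(\cdot-\epsilon_i)$ and $\epsilon_i$ is the $i$-th coordinate vector of $\mathbb Z^d$. For smooth $f,g$, "$f(\xi)=g(\xi)+O(\|\xi\|^n)$" means that all partial derivatives of order less than $n$ agree at $\xi=0$. Let $[S_av](k)=\lambda^d\sum_z v(z)a(k-\lambda z)$ be the subdivision operator of $a\in l_0^{r\times r}$. Norms of columns of sequences are the sums of the norms of the entries. The filter $a\in l_0^{r\times r}$ has *order $n$ sum rules with matching filter* $y\in l_0^{1\times r}$ if $\widehat y(0)\neq0$ and $\widehat y(\lambda\xi)\widehat a(\xi+2\pi\omega)=\delta(\omega)\widehat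 y(\xi)+O(\|\xi\|^n)$ for all $\omega\in\Omega:=\lambda^{-1}\mathbb Z^d\cap[0,1)^d$; $\mathrm{sr}(a)$ is the supremum of all $n\ge 0$ for which such a $y$ exists. The filter $a$ is an *order $n$ scalar-type filter* if it has order $n$ sum rules with matching filter $\delta e_1^{\mathsf T}=[\delta,0,\dots,0]$. For $y\in l_0^{1\times r}$, $j\ge0$ and $\mu\in\mathbb N_0^d$ put $V_{j-1,y}=\{w\in l_0^{r\times1}:\widehat y\,\widehat w=O(\|\xi\|^j)\}$ (all of $l_0^{r\times 1}$ if $j=0$), $\beta_{y,u,\mu}=\partial^\mu[\widehat y\,\widehat u](0)/(i^{|\mu|}\mu!)$ and $M_{y,\mu}=\{u\in l_0^{r\times1}:\widehat y(\xi)\widehat u(\xi)=\beta_{y,u,\mu}(i\xi)^\mu+O(\|\xi\|^{|\mu|+1})\}$. A subset $G$ of $W\subseteq l_0^{r\times1}$ *generates* $W$ if every $w\in W$ is a finite sum $\sum_i w_i*c_i$ with $w_i\in G$, $c_i\in l_0^{1\times1}$. For $1\le p\le\infty$ let $$\rho_j(a,y)_p=\sup_{w\in V_{j-1,y}}\limsup_{n\to\infty}\|[S_a^n(\delta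 I_r)]*w\|_{\ell_p}^{1/n},$$ let $\rho(a)_p$ be the infimum of $\rho_j(a,y)_p$ over all integers $0\le j\le\mathrm{sr}(a)$ and all order $j$ matching filters $y$ of $a$, and let $\mathrm{sm}_p(a,\lambda I_d)=\frac dp-\log_\lambda\rho(a)_p$ (with $\log_\lambda 0=-\infty$). Let $y$ be an order $m+1$ matching filter of $a$. The scheme with the filter $a$ is *$C^m$-convergent with respect to $y$* if for every $v\in l_0^{1\times r}$ there is $\eta_v\in C^m(\mathbb R^d)$ with $\lim_{n\to\infty}\sup_{k\in\mathbb Z^d}\bigl|\lambda^{|\mu|n}[(S_a^nv)*u](k)-\beta_{y,u,\mu}\,\partial^\mu\eta_v(\lambda^{-n}k)\bigr|=0$ for all $|\mu|\le m$ and all $u\in M_{y,\mu}$. It is *$C^m$-convergent* if this holds for some order $m+1$ matching filter $y$ of $a$. **Theorem.** Let $a\in l_0^{r\times r}$ have order $m+1$ sum rules with matching filter $\upsilon_a$. Let $U\in l_0^{r\times r}$ be strongly invertible, that is, $\det\widehat U(\xi)=c_0e^{-ik\cdot\xi}$ for some $c_0\ne0$ and $k\in\mathbb Z^d$, and let $\widehat{\upsilon_a}(\xi)\widehat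 U(\xi)=[1,0,\dots,0]+O(\|\xi\|^{m+1})$. Then there is a filter $\mathring a\in l_0^{r\times r}$ with $\widehat{\mathring a}(\xi)=\widehat U(\lambda\xi)^{-1}\widehat a(\xi)\widehat U(\xi)$ for all $\xi\in\mathbb R^d$, and the following hold. 1. For every $r\times1$ vector $\phi$ of compactly supported distributions with $\widehat\phi(\lambda\xi)=\widehat a(\xi)\widehat\phi(\xi)$ and $\widehat{\upsilon_a}(0)\widehat\phi(0)=1$ there is a vector $\mathring\phi$ of compactly supported distributions with $\widehat{\mathring\phi}(\xi)=\widehat U(\xi)^{-1}\widehat\phi(\xi)$, and it satisfies $\widehat{\mathring\phi}(\lambda\xi)=\widehat{\mathring a}(\xi)\widehat{\mathring\phi}(\xi)$ and $[1,0,\dots,0]\widehat{\mathring\phi}(0)=1$. 2. $\mathring a$ is an order $m+1$ scalar-type filter. 3. For all $0\le j\le m+1$ and all $|\mu|\le m$, the maps $w\mapsto U*w$ from $V_{j-1,\delta e_1^{\mathsf T}}$ to $V_{j-1,\upsilon_a}$ and $u\mapsto U*u$ from $M_{\delta e_1^{\mathsf T},\mu}$ to $M_{\upsilon_a,\mu}$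 are bijections. The set $\{U*\nabla^\nu\delta e_1:|\nu|=j\}\cup\{U*\delta e_l:2\le l\le r\}$ generates $V_{j-1,\upsilon_a}$. The set $\{U*\nabla^\nu\delta e_1:\nu=\mu\text{ or }|\nu|=|\mu|+1\}\cup\{U*\delta e_l:2\le l\le r\}$ generates $M_{\upsilon_a,\mu}$; if $d=1$ or $\mu=0$, then already $\{U*\nabla^\mu\delta e_1\}\cup\{U*\delta e_l:2\le l\le r\}$ generates $M_{\upsilon_a,\mu}$. 4. Put $a_n=\lambda^{-dn}S_a^n(\delta I_r)$ and $\mathring a_n=\lambda^{-dn}S_{\mathring a}^n(\delta I_r)$. For all $0\le j\le m+1$, $\mathring w\in V_{j-1,\delta e_1^{\mathsf T}}$, $w=U*\mathring w$ and $n\ge0$, we have $\widehat{a_n}(\xi)\widehat w(\xi)=\widehat U(\lambda^n\xi)\widehat{\mathring a_n}(\xi)\widehat{\mathring w}(\xi)$ for all $\xi$, and $$[S_a^n(\delta I_r)]*w=[S_{\mathring a}^nU]*\mathring w=\sum_{z\in\mathbb Z^d}U(z)\bigl[(S_{\mathring a}^n(\delta I_r))*\mathring w\bigr](\cdot-\lambda^nz).$$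 For all $1\le p\le\infty$ we have $\limsup_n\|[S_a^n(\delta I_r)]*w\|_{\ell_p}^{1/n}\le\limsup_n\|[S_{\mathring a}^n(\delta I_r)]*\mathring w\|_{\ell_p}^{1/n}$ for these $\mathring w$ and $w$, and $\rho_j(a,\upsilon_a)_p=\rho_j(\mathring a,\delta e_1^{\mathsf T})_p$ for $0\le j\le m+1$. Moreover, $\rho(a)_p=\rho(\mathring a)_p$ and $\mathrm{sm}_p(a,\lambda I_d)=\mathrm{sm}_p(\mathring a,\lambda I_d)$. Finally, the scheme with $a$ is $C^m$-convergent with respect to $\upsilon_a$ if and only if the scheme with $\mathring a$ is $C^m$-convergent with respect to $\delta e_1^{\mathsf T}$; and the scheme with $a$ is $C^m$-convergent if and only if the scheme with $\mathring a$ is. -/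

import Mathlib

open scoped ENNReal SchwartzMap

noncomputable section

namespace VecSubdivision

/-! ### Filters and their Fourier series -/

/-- The Euclidean space `ℝ^d`. -/
abbrev Rd (d : ℕ) : Type := EuclideanSpace ℝ (Fin d)

/-- Scalar filters: finitely supported sequences `ℤ^d → ℂ`. The multiplication of this
commutative ring is the convolution, and its unit is the Kronecker sequence `δ`. -/
abbrev ScalarFilter (d : ℕ) : Type := AddMonoidAlgebra ℂ (Fin d → ℤ)

/-- Finitely supported `s × t` matrix-valued sequences on `ℤ^d`, given by the matrices of their
entry sequences. Matrix multiplication over `ScalarFilter d` is the convolution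
`[v * w](k) = ∑_z v(z) w(k - z)`, and the identity matrix is `δ I_r`
(see `conv_val`). -/
abbrev Filt (d s t : ℕ) : Type := Matrix (Fin s) (Fin t) (ScalarFilter d)

variable {d r s t : ℕ}

/-- The matrix `u(k)`, for `k ∈ ℤ^d`. -/
def val (u : Filt d s t) (k : Fin d → ℤ) : Matrix (Fin s) (Fin t) ℂ :=
  Matrix.of fun i j => (u i j).coeff k

/-- The Fourier series `û(ξ) = ∑_k u(k) e^{-i k·ξ}`. -/
def fourierSeries (u : Filt d s t) (ξ : Rd d) : Matrix (Fin s) (Fin t) ℂ :=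
  Matrix.of fun i j =>
    (u i j).coeff.sum fun k c => c * Complex.exp (-(Complex.I * ∑ l, (k l : ℂ) * (ξ l : ℂ)))

/-- The row filter `δ e₁ᵀ = [δ, 0, …, 0]`. -/
def rowE1 (d r : ℕ) [NeZero r] : Filt d 1 r :=
  Matrix.of fun _ j => if j = 0 then 1 else 0

/-- The column filter `c e_l`. -/
def colFilter (c : ScalarFilter d) (l : Fin r) : Filt d r 1 :=
  Matrix.of fun i _ => if i = l then c else 0

/-- `∇^μ δ`, where `∇^μ = ∇_{e₁}^{μ₁} ⋯ ∇_{e_d}^{μ_d}` and `∇_h v = v - v(· - h)`, which is the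
convolution of `v` with `δ - δ(· - h)`. -/
def nablaDelta (μ : Fin d → ℕ) : ScalarFilter d :=
  ∏ i, (1 - AddMonoidAlgebra.single (Pi.single i 1) 1) ^ μ i

/-- `U` is strongly invertible: `det Û(ξ) = c₀ e^{-i k·ξ}` with `c₀ ≠ 0` and `k ∈ ℤ^d`. -/
def StronglyInvertible (U : Filt d r r) : Prop :=
  ∃ c₀ : ℂ, c₀ ≠ 0 ∧ ∃ k : Fin d → ℤ, ∀ ξ : Rd d,
    (fourierSeries U ξ).det = c₀ * Complex.exp (-(Complex.I * ∑ l, (k l : ℂ) * (ξ l : ℂ)))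

/-! ### The subdivision operator -/

/-- The sequence that takes the value `v(z)` at `N z` and vanishes off `N ℤ^d`. -/
def upsample (N : ℕ) (v : Filt d s t) : Filt d s t :=
  v.map (AddMonoidAlgebra.mapDomain fun k => N • k)

/-- The subdivision operator `[S_a v](k) = lam^d ∑_z v(z) a(k - lam z)` (see `subdiv_val`). -/
def subdiv (lam : ℕ) (a : Filt d r r) (v : Filt d s r) : Filt d s r :=
  ((lam : ℂ) ^ d) • (upsample lam v * a)

/-- `S_a^n v`. -/
def subdivIter (lam : ℕ) (a : Filt d r r) (n : ℕ) (v : Filt d s r) : Filt d s r :=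
  (subdiv lam a)^[n] v

/-- `a_n = lam^{-dn} S_a^n (δ I_r)`. -/
def iterFilter (lam : ℕ) (a : Filt d r r) (n : ℕ) : Filt d r r :=
  ((lam : ℂ) ^ (d * n))⁻¹ • subdivIter lam a n (1 : Filt d r r)

theorem val_map_mul (f : (Fin d → ℤ) → (Fin d → ℤ)) (v : Filt d s r) (w : Filt d r t)
    (k : Fin d → ℤ) :
    val (v.map (AddMonoidAlgebra.mapDomain f) * w) k = ∑ᶠ z, val v z * val w (k - f z) := by
  classical
  set S : Finset (Fin d → ℤ) :=
    Finset.univ.biUnion fun i => Finset.univ.biUnion fun l => (v i l).coeff.support with hS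
  have hmem : ∀ i l z, (v i l).coeff z ≠ 0 → z ∈ S := by
    intro i l z hz
    simp only [hS, Finset.mem_biUnion, Finset.mem_univ, true_and, Finsupp.mem_support_iff]
    exact ⟨i, l, hz⟩
  have hsub : Function.support (fun z => val v z * val w (k - f z)) ⊆ (S : Set (Fin d → ℤ)) := by
    intro z hz
    by_contra hzS
    apply hz
    have h0 : val v z = 0 := by
      ext i l
      by_contra h
      exact hzS (hmem i l z h)
    simp [h0]
  rw [finsum_eq_sum_of_support_subset _ hsub]
  ext i j
  simp only [val, Matrix.of_apply, Matrix.mul_apply, Matrix.map_apply, Matrix.sum_apply,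
    AddMonoidAlgebra.coeff_sum, Finsupp.finsetSum_apply]
  rw [Finset.sum_comm]
  refine Finset.sum_congr rfl fun l _ => ?_
  rw [AddMonoidAlgebra.coeff_mul_apply_left, AddMonoidAlgebra.mapDomain,
    AddMonoidAlgebra.coeff_ofCoeff, Finsupp.sum_mapDomain_index (by simp) (by simp [add_mul]),
    Finsupp.sum]
  refine Finset.sum_subset_zero_on_sdiff (fun z hz => hmem i l z (by simpa using hz)) ?_ ?_
  · intro z hz
    have : (v i l).coeff z = 0 := by simpa using (Finset.mem_sdiff.1 hz).2
    simp [this]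
  · intro z _
    rw [sub_eq_neg_add]

theorem conv_val (v : Filt d s r) (w : Filt d r t) (k : Fin d → ℤ) :
    val (v * w) k = ∑ᶠ z, val v z * val w (k - z) := by
  have h : v.map (AddMonoidAlgebra.mapDomain id) = v := by
    ext i j : 2
    simp [AddMonoidAlgebra.mapDomain]
  have h2 := val_map_mul id v w k
  rwa [h] at h2

theorem subdiv_val (lam : ℕ) (a : Filt d r r) (v : Filt d s r) (k : Fin d → ℤ) :
    val (subdiv lam a v) k = (lam : ℂ) ^ d • ∑ᶠ z, val v z * val a (k - lam • z) := by
  rw [← val_map_mul (fun z => lam • z) v a k]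
  ext i j
  simp [val, subdiv, upsample]

/-! ### Partial derivatives and the `O`-relation at the origin -/

/-- The partial derivative `∂_i f`. -/
def pderiv (i : Fin d) (f : Rd d → ℂ) : Rd d → ℂ :=
  fun x => lineDeriv ℝ f x (EuclideanSpace.single i 1)

/-- `∂^μ f = ∂₁^{μ₁} ⋯ ∂_d^{μ_d} f`. -/
def mderiv (μ : Fin d → ℕ) (f : Rd d → ℂ) : Rd d → ℂ :=
  (List.finRange d).foldr (fun i g => (pderiv i)^[μ i] g) f

/-- `|μ| = μ₁ + ⋯ + μ_d`. -/
def deg (μ : Fin d → ℕ) : ℕ := ∑ i, μ i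

/-- `f(ξ) = g(ξ) + O(‖ξ‖^n)` as `ξ → 0`, for smooth matrix-valued `f` and `g`: all partial
derivatives of order less than `n` agree at `0`. -/
def EqO (n : ℕ) (f g : Rd d → Matrix (Fin s) (Fin t) ℂ) : Prop :=
  ∀ i j, ∀ μ : Fin d → ℕ, deg μ < n →
    mderiv μ (fun ξ => f ξ i j) 0 = mderiv μ (fun ξ => g ξ i j) 0

/-! ### Sum rules and moment spaces -/

/-- `Ω = [lam⁻¹ ℤ^d] ∩ [0,1)^d`. -/
def Omega (d lam : ℕ) : Set (Rd d) :=
  {ω | (∃ k : Fin d → ℤ, ∀ i, ω i = (lam : ℝ)⁻¹ * k i) ∧ ∀ i, 0 ≤ ω i ∧ ω i < 1}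

open Classical in
/-- `a` has order `n` sum rules with the matching filter `y`: `ŷ(0) ≠ 0` and
`ŷ(lam ξ) â(ξ + 2πω) = δ(ω) ŷ(ξ) + O(‖ξ‖^n)` for all `ω ∈ Ω`. -/
def SumRules (lam n : ℕ) (a : Filt d r r) (y : Filt d 1 r) : Prop :=
  fourierSeries y 0 ≠ 0 ∧ ∀ ω ∈ Omega d lam,
    EqO n (fun ξ => fourierSeries y ((lam : ℝ) • ξ) * fourierSeries a (ξ + (2 * Real.pi) • ω))
      (fun ξ => (if ω = 0 then (1 : ℂ) else 0) • fourierSeries y ξ)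

/-- Order `n` scalar-type filters: order `n` sum rules with the matching filter `[δ, 0, …, 0]`. -/
def IsScalarType [NeZero r] (lam n : ℕ) (a : Filt d r r) : Prop :=
  SumRules lam n a (rowE1 d r)

/-- `sr(a)`, the largest order of sum rules of `a`. -/
def sumRuleOrder (lam : ℕ) (a : Filt d r r) : ℕ∞ :=
  ⨆ (n : ℕ) (_ : ∃ y : Filt d 1 r, SumRules lam n a y), (n : ℕ∞)

/-- The space `V_{j-1,y} = {w : ŷ(ξ) ŵ(ξ) = O(‖ξ‖^j)}`, for `j ≥ 0`; `V_{-1,y}` is the space of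
all `r × 1` filters. -/
def V (j : ℕ) (y : Filt d 1 r) : Set (Filt d r 1) :=
  {w | EqO j (fun ξ => fourierSeries y ξ * fourierSeries w ξ) (fun _ => 0)}

/-- `β_{y,u,μ} = ∂^μ[ŷ û](0) / (i^{|μ|} μ!)`. -/
def beta (y : Filt d 1 r) (u : Filt d r 1) (μ : Fin d → ℕ) : ℂ :=
  mderiv μ (fun ξ => (fourierSeries y ξ * fourierSeries u ξ) 0 0) 0 /
    (Complex.I ^ deg μ * ∏ i, ((μ i).factorial : ℂ))

/-- The moment space `M_{y,μ} = {u : ŷ(ξ) û(ξ) = β_{y,u,μ} (iξ)^μ + O(‖ξ‖^{|μ|+1})}`. -/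
def M (y : Filt d 1 r) (μ : Fin d → ℕ) : Set (Filt d r 1) :=
  {u | EqO (deg μ + 1) (fun ξ => fourierSeries y ξ * fourierSeries u ξ)
    (fun ξ => Matrix.of fun _ _ => beta y u μ * ∏ i, (Complex.I * (ξ i : ℂ)) ^ μ i)}

/-- `G` is a subset of `W` that generates `W`: every `w ∈ W` is a finite sum
`w₁ * c₁ + ⋯ + w_N * c_N` with `w_i ∈ G` and scalar filters `c_i`. -/
def Generates (G W : Set (Filt d r 1)) : Prop :=
  G ⊆ W ∧ ∀ w ∈ W, w ∈ Submodule.span (ScalarFilter d) G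

/-! ### The smoothness exponent -/

/-- The `ℓ_p` norm of a sequence on `ℤ^d`, with values in `[0, ∞]`. -/
def seqNorm (p : ℝ≥0∞) (f : (Fin d → ℤ) → ℂ) : ℝ≥0∞ :=
  MeasureTheory.eLpNorm f p MeasureTheory.Measure.count

/-- The norm of `(ℓ_p)^{r × 1}`: the sum of the `ℓ_p` norms of the entries. -/
def colNorm (p : ℝ≥0∞) (w : Filt d r 1) : ℝ≥0∞ :=
  ∑ i, seqNorm p fun k => (w i 0).coeff k

/-- `limsup_n ‖[S_a^n (δ I_r)] * w‖_p^{1/n}`. -/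
def growthRate (lam : ℕ) (a : Filt d r r) (p : ℝ≥0∞) (w : Filt d r 1) : ℝ≥0∞ :=
  Filter.limsup (fun n : ℕ => colNorm p (subdivIter lam a n (1 : Filt d r r) * w) ^ (1 / (n : ℝ))) Filter.atTop

/-- `ρ_j(a, y)_p`, the supremum of the growth rates over `V_{j-1,y}`. -/
def rhoAt (lam : ℕ) (a : Filt d r r) (y : Filt d 1 r) (p : ℝ≥0∞) (j : ℕ) : ℝ≥0∞ :=
  ⨆ w ∈ V j y, growthRate lam a p w

/-- `ρ(a)_p`, the infimum of `ρ_j(a, y)_p` over all `0 ≤ j ≤ sr(a)` and all order `j` matching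
filters `y` of `a`. -/
def rho (lam : ℕ) (a : Filt d r r) (p : ℝ≥0∞) : ℝ≥0∞ :=
  ⨅ (j : ℕ) (y : Filt d 1 r) (_ : (j : ℕ∞) ≤ sumRuleOrder lam a ∧ SumRules lam j a y),
    rhoAt lam a y p j

/-- The smoothness exponent `sm_p(a) = d/p - log_lam ρ(a)_p`, with `d/∞ = 0` and
`log_lam 0 = -∞`. -/
def sm (lam : ℕ) (a : Filt d r r) (p : ℝ≥0∞) : EReal :=
  (((d : ℝ≥0∞) / p : ℝ≥0∞) : EReal) - ENNReal.log (rho lam a p) / ((Real.log lam : ℝ) : EReal)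

/-! ### Convergence of subdivision schemes -/

/-- The point `lam^{-n} k ∈ ℝ^d`. -/
def gridPoint (lam n : ℕ) (k : Fin d → ℤ) : Rd d :=
  WithLp.toLp 2 fun i => ((lam : ℝ) ^ n)⁻¹ * (k i : ℝ)

/-- The subdivision scheme with the filter `a` is `C^m`-convergent with respect to the order
`m + 1` matching filter `y` of `a`. -/
def CmConvergentWith (lam m : ℕ) (a : Filt d r r) (y : Filt d 1 r) : Prop :=
  SumRules lam (m + 1) a y ∧
  ∀ v : Filt d 1 r, ∃ η : Rd d → ℂ, ContDiff ℝ m η ∧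
    ∀ μ : Fin d → ℕ, deg μ ≤ m → ∀ u ∈ M y μ,
      Filter.Tendsto
        (fun n : ℕ => seqNorm ∞ fun k : Fin d → ℤ =>
          (lam : ℂ) ^ (deg μ * n) * ((subdivIter lam a n v * u) 0 0).coeff k
            - beta y u μ * mderiv μ η (gridPoint lam n k))
        Filter.atTop (nhds 0)

/-- The subdivision scheme with the filter `a` is `C^m`-convergent: `a` has order `m + 1` sum
rules, and the scheme converges with respect to a matching filter of `a`. -/
def CmConvergent (lam m : ℕ) (a : Filt d r r) : Prop :=
  ∃ y : Filt d 1 r, CmConvergentWith lam m a y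

/-! ### Refinable vectors of compactly supported distributions -/

/-- The Fourier transform of the tempered distribution `T`, in the normalization
`f̂(ξ) = ∫ f(x) e^{-i x·ξ} dx`, is the smooth function `F`. Mathlib's transform uses the kernel
`e^{-2πi x·ξ}`, hence is `ξ ↦ F(2πξ)`. -/
def HasFourier (T : 𝓢'(Rd d, ℂ)) (F : Rd d → ℂ) : Prop :=
  ∃ h : Function.HasTemperateGrowth (fun ξ : Rd d => F ((2 * Real.pi) • ξ)),
    FourierTransform.fourier T =
      Function.HasTemperateGrowth.toTemperedDistribution MeasureTheory.volume h

/-- `Φ` is the Fourier transform of the vector `φ` of distributions. -/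
def HasFourierVec (φ : Fin r → 𝓢'(Rd d, ℂ)) (Φ : Rd d → Fin r → ℂ) : Prop :=
  ∀ l, HasFourier (φ l) fun ξ => Φ ξ l

/-- `φ` is a vector of compactly supported distributions with `φ̂(lam ξ) = â(ξ) φ̂(ξ)` and
`ŷ(0) φ̂(0) = 1`. -/
def IsStandardRefinable (lam : ℕ) (a : Filt d r r) (y : Filt d 1 r)
    (φ : Fin r → 𝓢'(Rd d, ℂ)) : Prop :=
  (∀ l, IsCompact (Distribution.dsupport (φ l))) ∧
  ∃ Φ : Rd d → Fin r → ℂ, HasFourierVec φ Φ ∧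
    (∀ ξ, Φ ((lam : ℝ) • ξ) = (fourierSeries a ξ).mulVec (Φ ξ)) ∧
    (fourierSeries y 0).mulVec (Φ 0) = 1

end VecSubdivision

end

open VecSubdivision

/-! Filters are matrices over the ring of Laurent polynomials, and a Fourier series is an evaluation
of such polynomials that determines them (`evalHom_injective`). Hence the determinant of a strongly
invertible `U` is a unit of this ring, `U` has a convolution inverse `W`, and the transformed filter
is `upsample lam W * a * U`.

Everything else rests on the single relation `a * U = upsample lam U * a'`, recorded in
`Conjugates`. It says that right convolution with `U` intertwines the two subdivision operators, and
it is symmetric under exchanging `(U, a)` with `(W, a')`, so each one-sided statement about `U`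
yields its converse. Sum rules pass from `y` to `y * U` because the dilated series of `U` is
invariant under the shifts by `2πω`. Moment spaces are pulled back because `y * (U * w) = (y * U) *
w`. The same cancellation `W * U = 1` transports convergence with an unchanged limit function.

For growth rates, the iterate for `a` applied to `U * w` is the iterate for `a'` applied to `w`,
convolved with `U` upsampled by `lam ^ n`. Upsampling does not change the size of the coefficients,
so this costs a constant independent of `n`, whose `n`-th root tends to 1
(`Conjugates.growthRate_le`).

The row `y * U` agrees with `rowE1` only up to order `m + 1`. This suffices, since the sum rules of
order `m + 1`, the spaces `V j` with `j ≤ m + 1` and the data `M`, `beta` with `deg μ ≤ m` see the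
row only to that order (`RowEqO`).

For the row `rowE1` only the first entry of a column is constrained, so generation is a question
about ideals. Its answer is `vanishingIdeal_eq_nablaIdeal`: the filters vanishing to order `j` at
the origin form the ideal of the differences of order `j`. The refinable vector is convolved with
`W`, a finite combination of integer translates, which keeps supports compact. -/

open VecSubdivision

namespace VecSubdivision

variable {d r s t : ℕ}

/-! ### Fourier series as ring homomorphisms -/

/-- The character `k ↦ e^{-i k·ξ}`. -/
noncomputable def expChar (ξ : Rd d) : Multiplicative (Fin d → ℤ) →* ℂ where
  toFun k := Complex.exp (-(Complex.I * ∑ l, (k.toAdd l : ℂ) * (ξ l : ℂ)))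
  map_one' := by simp
  map_mul' k k' := by
    rw [← Complex.exp_add]
    congr 1
    simp only [toAdd_mul, Pi.add_apply, Int.cast_add, add_mul, Finset.sum_add_distrib]
    ring

theorem expChar_add (ξ η : Rd d) (k : Multiplicative (Fin d → ℤ)) :
    expChar (ξ + η) k = expChar ξ k * expChar η k := by
  simp only [expChar, MonoidHom.coe_mk, OneHom.coe_mk, ← Complex.exp_add]
  congr 1
  simp only [PiLp.add_apply, Complex.ofReal_add, mul_add, Finset.sum_add_distrib]
  ring

/-- The Fourier series of a scalar filter at `ξ`. -/
noncomputable def evalHom (ξ : Rd d) : ScalarFilter d →ₐ[ℂ] ℂ :=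
  AddMonoidAlgebra.lift ℂ ℂ (Fin d → ℤ) (expChar ξ)

theorem evalHom_single (ξ : Rd d) (k : Fin d → ℤ) (c : ℂ) :
    evalHom ξ (AddMonoidAlgebra.single k c) =
      c * Complex.exp (-(Complex.I * ∑ l, (k l : ℂ) * (ξ l : ℂ))) := by
  rw [evalHom, AddMonoidAlgebra.lift_single]
  rfl

theorem evalHom_single_eq (ξ : Rd d) (k : Fin d → ℤ) (c : ℂ) :
    evalHom ξ (AddMonoidAlgebra.single k c) = c * expChar ξ (Multiplicative.ofAdd k) := by
  rw [evalHom, AddMonoidAlgebra.lift_single]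
  rfl

theorem fourierSeries_apply (u : Filt d s t) (ξ : Rd d) (i : Fin s) (j : Fin t) :
    fourierSeries u ξ i j = evalHom ξ (u i j) := by
  rw [evalHom, AddMonoidAlgebra.lift_apply]
  rfl

theorem fourierSeries_eq_map (u : Filt d s t) (ξ : Rd d) :
    fourierSeries u ξ = u.map (evalHom ξ) := by
  ext i j
  rw [fourierSeries_apply, Matrix.map_apply]

theorem fourierSeries_mul {q : ℕ} (u : Filt d s t) (v : Filt d t q) (ξ : Rd d) :
    fourierSeries (u * v) ξ = fourierSeries u ξ * fourierSeries v ξ := by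
  simp only [fourierSeries_eq_map, Matrix.map_mul]

theorem fourierSeries_one (ξ : Rd d) : fourierSeries (1 : Filt d r r) ξ = 1 := by
  rw [fourierSeries_eq_map, Matrix.map_one _ (map_zero _) (map_one _)]

theorem fourierSeries_smul (c : ℂ) (u : Filt d s t) (ξ : Rd d) :
    fourierSeries (c • u) ξ = c • fourierSeries u ξ := by
  ext i j
  simp [fourierSeries_apply]

theorem fourierSeries_rowE1 [NeZero r] (ξ : Rd d) :
    fourierSeries (rowE1 d r) ξ = Matrix.of fun _ j => if j = 0 then 1 else 0 := by
  ext i j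
  rw [fourierSeries_apply]
  by_cases h : j = 0 <;> simp [rowE1, h]

theorem fourierSeries_det (u : Filt d r r) (ξ : Rd d) :
    (fourierSeries u ξ).det = evalHom ξ u.det := by
  rw [fourierSeries_eq_map]
  exact (RingHom.map_det (evalHom ξ).toRingHom u).symm

/-- The derivative at 0 along the `i`-th axis is `-i k_i`, so the character recovers every
coordinate of `k`. -/
theorem expChar_injective :
    Function.Injective fun k : Fin d → ℤ => fun ξ : Rd d => expChar ξ (Multiplicative.ofAdd k) := by
  intro k k' h
  funext i
  have key : ∀ x : ℝ, Complex.exp (-(Complex.I * ((k i : ℂ) * x))) =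
      Complex.exp (-(Complex.I * ((k' i : ℂ) * x))) := by
    intro x
    have := congrFun h (EuclideanSpace.single i x)
    simpa [expChar, PiLp.single_apply, apply_ite] using this
  have hd : ∀ n : ℤ, HasDerivAt (fun x : ℝ => Complex.exp (-(Complex.I * ((n : ℂ) * x))))
      (-(Complex.I * n)) 0 := by
    intro n
    have h1 : HasDerivAt (fun x : ℝ => -(Complex.I * ((n : ℂ) * (x : ℂ)))) (-(Complex.I * (n * 1))) 0 :=
      (((Complex.ofRealCLM.hasDerivAt (x := (0 : ℝ))).const_mul (n : ℂ)).const_mul Complex.I).neg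
    simpa using h1.cexp
  have h1 := hd (k i)
  rw [funext key] at h1
  have := h1.unique (hd (k' i))
  simpa [Complex.I_ne_zero] using this

/-- For distinct `k` the functions `ξ ↦ e^{-i k·ξ}` are distinct characters of the additive group
`ℝ^d`, hence linearly independent by Dedekind's theorem. -/
theorem evalHom_injective {c c' : ScalarFilter d} (h : ∀ ξ, evalHom ξ c = evalHom ξ c') :
    c = c' := by
  let F : (Fin d → ℤ) → (Multiplicative (Rd d) →* ℂ) := fun k =>
    { toFun := fun ξ => expChar ξ.toAdd (Multiplicative.ofAdd k)
      map_one' := by simp [expChar]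
      map_mul' := fun ξ η => expChar_add _ _ _ }
  have hF : Function.Injective F := by
    intro k k' hk
    apply expChar_injective
    funext ξ
    exact DFunLike.congr_fun hk (Multiplicative.ofAdd ξ)
  have hli : LinearIndependent ℂ fun k => (F k : Multiplicative (Rd d) → ℂ) :=
    (linearIndependent_monoidHom (Multiplicative (Rd d)) ℂ).comp F hF
  have : c.coeff = c'.coeff := by
    apply hli
    funext ξ
    have := h ξ.toAdd
    simp only [evalHom, AddMonoidAlgebra.lift_apply] at this
    simpa [Finsupp.linearCombination_apply, Finsupp.sum, F] using this
  exact AddMonoidAlgebra.coeff_injective this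

/-- A strongly invertible filter has an inverse with respect to convolution. -/
theorem StronglyInvertible.exists_inverse {U : Filt d r r} (hU : StronglyInvertible U) :
    ∃ W : Filt d r r, U * W = 1 ∧ W * U = 1 := by
  obtain ⟨c₀, hc, k, h⟩ := hU
  have hdet : U.det = AddMonoidAlgebra.single k c₀ := by
    apply evalHom_injective
    intro ξ
    rw [← fourierSeries_det, h, evalHom_single]
  have hunit : IsUnit U.det := by
    refine IsUnit.of_mul_eq_one (AddMonoidAlgebra.single (-k) c₀⁻¹) ?_
    rw [hdet, AddMonoidAlgebra.single_mul_single, add_neg_cancel, mul_inv_cancel₀ hc]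
    rfl
  exact ⟨U⁻¹, U.mul_nonsing_inv hunit, U.nonsing_inv_mul hunit⟩

theorem fourierSeries_inv {U W : Filt d r r} (h : U * W = 1) (ξ : Rd d) :
    (fourierSeries U ξ)⁻¹ = fourierSeries W ξ := by
  apply Matrix.inv_eq_right_inv
  rw [← fourierSeries_mul, h, fourierSeries_one]

/-! ### Upsampling and modulation -/

/-- Upsampling of scalar filters as a ring homomorphism. -/
noncomputable def upsampleHom (d N : ℕ) : ScalarFilter d →+* ScalarFilter d :=
  AddMonoidAlgebra.mapDomainRingHom ℂ (nsmulAddMonoidHom N)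

theorem upsample_eq (N : ℕ) (v : Filt d s t) : upsample N v = v.map (upsampleHom d N) := rfl

theorem upsampleHom_single (N : ℕ) (k : Fin d → ℤ) (c : ℂ) :
    upsampleHom d N (AddMonoidAlgebra.single k c) = AddMonoidAlgebra.single (N • k) c :=
  AddMonoidAlgebra.mapDomain_single

theorem upsample_mul {q : ℕ} (N : ℕ) (u : Filt d s t) (v : Filt d t q) :
    upsample N (u * v) = upsample N u * upsample N v := by
  simp only [upsample_eq, Matrix.map_mul]

theorem upsample_one (N : ℕ) : upsample N (1 : Filt d r r) = 1 := by
  rw [upsample_eq, Matrix.map_one _ (map_zero _) (map_one _)]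

theorem upsampleHom_upsampleHom (N N' : ℕ) (x : ScalarFilter d) :
    upsampleHom d N (upsampleHom d N' x) = upsampleHom d (N * N') x := by
  induction x using AddMonoidAlgebra.induction_linear with
  | zero => simp
  | add x y hx hy => simp only [map_add, hx, hy]
  | single k b => simp only [upsampleHom_single, mul_smul]

theorem upsample_upsample (N N' : ℕ) (v : Filt d s t) :
    upsample N (upsample N' v) = upsample (N * N') v := by
  ext1 i j
  exact upsampleHom_upsampleHom N N' (v i j)

theorem upsample_one_left (v : Filt d s t) : upsample 1 v = v := by
  have : ∀ x : ScalarFilter d, upsampleHom d 1 x = x := by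
    intro x
    induction x using AddMonoidAlgebra.induction_linear with
    | zero => simp
    | add x y hx hy => simp only [map_add, hx, hy]
    | single k b => simp only [upsampleHom_single, one_smul]
  ext1 i j
  exact this (v i j)

theorem evalHom_upsampleHom (N : ℕ) (x : ScalarFilter d) (ξ : Rd d) :
    evalHom ξ (upsampleHom d N x) = evalHom ((N : ℝ) • ξ) x := by
  induction x using AddMonoidAlgebra.induction_linear with
  | zero => simp
  | add x y hx hy => simp only [map_add, hx, hy]
  | single k b =>
    rw [upsampleHom_single, evalHom_single, evalHom_single]
    congr 5
    funext l
    simp only [Pi.smul_apply, nsmul_eq_mul, PiLp.smul_apply, smul_eq_mul]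
    push_cast
    ring

theorem fourierSeries_upsample (N : ℕ) (v : Filt d s t) (ξ : Rd d) :
    fourierSeries (upsample N v) ξ = fourierSeries v ((N : ℝ) • ξ) := by
  ext i j
  rw [fourierSeries_apply, fourierSeries_apply]
  exact evalHom_upsampleHom N _ ξ

/-- Multiplication of the coefficients by `e^{-i k·η}`, which shifts the Fourier series by `η`. -/
noncomputable def modulateHom (η : Rd d) : ScalarFilter d →ₐ[ℂ] ScalarFilter d :=
  AddMonoidAlgebra.lift ℂ (ScalarFilter d) (Fin d → ℤ)
    { toFun := fun k => AddMonoidAlgebra.single k.toAdd (expChar η k)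
      map_one' := by rw [(expChar η).map_one]; rfl
      map_mul' := fun k k' => by
        rw [AddMonoidAlgebra.single_mul_single, (expChar η).map_mul, toAdd_mul] }

theorem modulateHom_single (η : Rd d) (k : Fin d → ℤ) (c : ℂ) :
    modulateHom η (AddMonoidAlgebra.single k c) =
      AddMonoidAlgebra.single k (c * expChar η (Multiplicative.ofAdd k)) := by
  rw [modulateHom, AddMonoidAlgebra.lift_single]
  exact AddMonoidAlgebra.smul_single _ _ _

/-- Entrywise modulation of a filter. -/
noncomputable def modulate (η : Rd d) (u : Filt d s t) : Filt d s t := u.map (modulateHom η)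

theorem modulate_mul {q : ℕ} (η : Rd d) (u : Filt d s t) (v : Filt d t q) :
    modulate η (u * v) = modulate η u * modulate η v := by
  simp only [modulate, Matrix.map_mul]

theorem modulate_zero (u : Filt d s t) : modulate 0 u = u := by
  have : ∀ x : ScalarFilter d, modulateHom 0 x = x := by
    intro x
    induction x using AddMonoidAlgebra.induction_linear with
    | zero => simp
    | add x y hx hy => simp only [map_add, hx, hy]
    | single k b => simp [modulateHom_single, expChar]
  ext1 i j
  exact this (u i j)

theorem evalHom_modulateHom (η : Rd d) (x : ScalarFilter d) (ξ : Rd d) :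
    evalHom ξ (modulateHom η x) = evalHom (ξ + η) x := by
  induction x using AddMonoidAlgebra.induction_linear with
  | zero => simp
  | add x y hx hy => simp only [map_add, hx, hy]
  | single k b =>
    rw [modulateHom_single, evalHom_single_eq, evalHom_single_eq, expChar_add]
    ring

theorem fourierSeries_modulate (η : Rd d) (u : Filt d s t) (ξ : Rd d) :
    fourierSeries (modulate η u) ξ = fourierSeries u (ξ + η) := by
  ext i j
  rw [fourierSeries_apply, fourierSeries_apply]
  exact evalHom_modulateHom η _ ξ

/-- An upsampled filter lives on `lam ℤ^d`, and `lam ω` is an integer vector, so every phase is a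
multiple of `2π`. This periodicity lets one factor serve all the sum rules at once. -/
theorem modulate_upsample {lam : ℕ} (hlam : lam ≠ 0) {ω : Rd d} (hω : ω ∈ Omega d lam)
    (u : Filt d s t) :
    modulate ((2 * Real.pi) • ω) (upsample lam u) = upsample lam u := by
  obtain ⟨⟨z, hz⟩, -⟩ := hω
  have : ∀ x : ScalarFilter d,
      modulateHom ((2 * Real.pi) • ω) (upsampleHom d lam x) = upsampleHom d lam x := by
    intro x
    induction x using AddMonoidAlgebra.induction_linear with
    | zero => simp
    | add x y hx hy => simp only [map_add, hx, hy]
    | single k b =>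
      rw [upsampleHom_single, modulateHom_single]
      have h0 : (lam : ℂ) ≠ 0 := Nat.cast_ne_zero.2 hlam
      have : expChar ((2 * Real.pi) • ω) (Multiplicative.ofAdd (lam • k)) = 1 := by
        simp only [expChar, MonoidHom.coe_mk, OneHom.coe_mk, Complex.exp_eq_one_iff]
        refine ⟨-∑ l, k l * z l, ?_⟩
        push_cast
        rw [Finset.mul_sum, neg_mul, Finset.sum_mul]
        congr 1
        refine Finset.sum_congr rfl fun l _ => ?_
        have hk : (lam • k) l = lam * k l := by simp
        simp only [toAdd_ofAdd, hk, PiLp.smul_apply, smul_eq_mul, hz]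
        push_cast
        field_simp
      rw [this, mul_one]
  ext1 i j
  exact this (u i j)

/-! ### Differentiation of Fourier series -/

/-- The filter with the coefficients `χ(k) c(k)`. -/
noncomputable def weight (χ : (Fin d → ℤ) → ℂ) : ScalarFilter d →ₗ[ℂ] ScalarFilter d where
  toFun c := AddMonoidAlgebra.ofCoeff
    (Finsupp.onFinset c.coeff.support (fun k => χ k * c.coeff k) fun k hk => by
      rw [Finsupp.mem_support_iff]
      exact right_ne_zero_of_mul hk)
  map_add' x y := by
    ext k
    simp [mul_add]
  map_smul' a x := by
    ext k
    simp [mul_left_comm]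

theorem weight_single (χ : (Fin d → ℤ) → ℂ) (k : Fin d → ℤ) (c : ℂ) :
    weight χ (AddMonoidAlgebra.single k c) = AddMonoidAlgebra.single k (χ k * c) := by
  classical
  ext k'
  by_cases h : k = k'
  · subst h
    simp [weight]
  · simp [weight, Finsupp.single_apply, h]

theorem weight_weight (χ ψ : (Fin d → ℤ) → ℂ) (c : ScalarFilter d) :
    weight χ (weight ψ c) = weight (fun k => χ k * ψ k) c := by
  ext k
  simp [weight, mul_assoc]

theorem weight_one (c : ScalarFilter d) : weight (fun _ => 1) c = c := by
  ext k
  simp [weight]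

/-- The operator on scalar filters that corresponds to `∂_i`. -/
noncomputable def filterDeriv (i : Fin d) : ScalarFilter d →ₗ[ℂ] ScalarFilter d :=
  weight fun k => -(Complex.I * (k i : ℂ))

/-- The symbol of `∂^μ`. -/
noncomputable def derivSymbol (μ : Fin d → ℕ) (k : Fin d → ℤ) : ℂ :=
  ∏ i, (-(Complex.I * (k i : ℂ))) ^ μ i

theorem derivSymbol_add_single (μ : Fin d → ℕ) (i : Fin d) (k : Fin d → ℤ) :
    derivSymbol (μ + Pi.single i 1) k = derivSymbol μ k * -(Complex.I * (k i : ℂ)) := by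
  simp only [derivSymbol, Pi.add_apply, pow_add, Finset.prod_mul_distrib]
  congr 1
  rw [Finset.prod_eq_single i]
  · simp
  · intro l _ hl
    simp [hl]
  · simp

/-- The weight `-i k_i` is additive in `k`, which makes the operator a derivation for convolution.
-/
theorem filterDeriv_mul (i : Fin d) (x y : ScalarFilter d) :
    filterDeriv i (x * y) = filterDeriv i x * y + x * filterDeriv i y := by
  induction x using AddMonoidAlgebra.induction_linear with
  | zero => simp
  | add x x' hx hx' => simp only [add_mul, map_add, hx, hx']; ring
  | single k b =>
    induction y using AddMonoidAlgebra.induction_linear with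
    | zero => simp
    | add y y' hy hy' => simp only [mul_add, map_add, hy, hy']; ring
    | single k' b' =>
      simp only [filterDeriv, weight_single, AddMonoidAlgebra.single_mul_single,
        ← AddMonoidAlgebra.single_add]
      congr 1
      simp only [Pi.add_apply, Int.cast_add]
      ring

theorem hasLineDerivAt_evalHom (i : Fin d) (c : ScalarFilter d) (ξ : Rd d) :
    HasLineDerivAt ℝ (fun ξ => evalHom ξ c) (evalHom ξ (filterDeriv i c)) ξ
      (EuclideanSpace.single i 1) := by
  induction c using AddMonoidAlgebra.induction_linear with
  | zero => simpa using hasFDerivAt_const (0 : ℂ) ξ |>.hasLineDerivAt (EuclideanSpace.single i 1)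
  | add x y hx hy =>
    simp only [map_add]
    exact HasDerivAt.add hx hy
  | single k b =>
    simp only [filterDeriv, weight_single]
    simp only [HasLineDerivAt, evalHom_single]
    have hsum : ∀ τ : ℝ, (∑ l, (k l : ℂ) *
        (((ξ + τ • EuclideanSpace.single i (1 : ℝ) : Rd d) l : ℝ) : ℂ)) =
        ∑ l, (k l : ℂ) * (ξ l : ℂ) + k i * τ := by
      intro τ
      simp only [PiLp.add_apply, PiLp.smul_apply, smul_eq_mul, Complex.ofReal_add,
        Complex.ofReal_mul, mul_add, Finset.sum_add_distrib]
      congr 1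
      rw [Finset.sum_eq_single i]
      · simp
      · intro l _ hl
        simp [hl]
      · simp
    simp only [hsum]
    have h1 : HasDerivAt
        (fun τ : ℝ => -(Complex.I * (∑ l, (k l : ℂ) * (ξ l : ℂ) + k i * (τ : ℂ))))
        (-(Complex.I * (k i * 1))) 0 :=
      (((Complex.ofRealCLM.hasDerivAt (x := (0 : ℝ))).const_mul (k i : ℂ)).const_add _
        |>.const_mul Complex.I).neg
    refine (h1.cexp.const_mul b).congr_deriv ?_
    simp only [Complex.ofReal_zero, mul_zero, add_zero, mul_one]
    ring

theorem pderiv_evalHom (i : Fin d) (c : ScalarFilter d) :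
    pderiv i (fun ξ => evalHom ξ c) = fun ξ => evalHom ξ (filterDeriv i c) := by
  funext ξ
  exact (hasLineDerivAt_evalHom i c ξ).lineDeriv

/-- Derivatives of Fourier series are again Fourier series, of weighted filters. This turns the
`O`-relations at the origin into algebra on coefficients. -/
theorem mderiv_evalHom (μ : Fin d → ℕ) (c : ScalarFilter d) :
    mderiv μ (fun ξ => evalHom ξ c) = fun ξ => evalHom ξ (weight (derivSymbol μ) c) := by
  have hiter : ∀ (i : Fin d) (n : ℕ) (c : ScalarFilter d),
      (pderiv i)^[n] (fun ξ => evalHom ξ c) =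
        fun ξ => evalHom ξ (weight (fun k => (-(Complex.I * (k i : ℂ))) ^ n) c) := by
    intro i n
    induction n with
    | zero => intro c; simp [weight_one]
    | succ n ih =>
      intro c
      rw [Function.iterate_succ_apply, pderiv_evalHom, ih, filterDeriv, weight_weight]
      simp only [pow_succ]
  have hL : ∀ L : List (Fin d), L.foldr (fun i g => (pderiv i)^[μ i] g) (fun ξ => evalHom ξ c) =
      fun ξ => evalHom ξ
        (weight (fun k => (L.map fun i => (-(Complex.I * (k i : ℂ))) ^ μ i).prod) c) := by
    intro L
    induction L with
    | nil => simp [weight_one]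
    | cons i L ih => simp only [List.foldr_cons, ih, hiter, weight_weight, List.map_cons,
        List.prod_cons]
  rw [mderiv, hL]
  have : derivSymbol μ = fun k : Fin d → ℤ =>
      ((List.finRange d).map fun i => (-(Complex.I * (k i : ℂ))) ^ μ i).prod := by
    funext k
    rw [derivSymbol, Fin.prod_univ_def]
  rw [this]

/-! ### Filters whose Fourier series vanish at the origin to a given order -/

/-- All the partial derivatives of `ĉ` of order less than `n` vanish at the origin. -/
def VanishesToOrder (n : ℕ) (c : ScalarFilter d) : Prop :=
  ∀ μ : Fin d → ℕ, deg μ < n → evalHom 0 (weight (derivSymbol μ) c) = 0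

theorem deg_add (μ ν : Fin d → ℕ) : deg (μ + ν) = deg μ + deg ν := by
  simp [deg, Finset.sum_add_distrib]

theorem deg_single (i : Fin d) : deg (Pi.single i 1) = 1 := by
  simp [deg]

theorem deg_eq_zero {μ : Fin d → ℕ} : deg μ = 0 ↔ μ = 0 := by
  simp [deg, funext_iff]

theorem derivSymbol_zero : derivSymbol (0 : Fin d → ℕ) = fun _ => 1 := by
  funext k
  simp [derivSymbol]

theorem exists_eq_add_single {μ : Fin d → ℕ} (h : deg μ ≠ 0) :
    ∃ (i : Fin d) (μ' : Fin d → ℕ), μ = μ' + Pi.single i 1 := by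
  have h1 : μ ≠ 0 := fun h' => h (deg_eq_zero.2 h')
  obtain ⟨i, hi⟩ := Function.ne_iff.1 h1
  refine ⟨i, μ - Pi.single i 1, ?_⟩
  funext l
  by_cases hl : l = i
  · subst hl
    simp only [Pi.zero_apply] at hi
    simp only [Pi.add_apply, Pi.sub_apply, Pi.single_eq_same]
    omega
  · simp [hl]

theorem weight_derivSymbol_add_single (μ : Fin d → ℕ) (i : Fin d) (c : ScalarFilter d) :
    weight (derivSymbol (μ + Pi.single i 1)) c = weight (derivSymbol μ) (filterDeriv i c) := by
  rw [filterDeriv, weight_weight]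
  simp only [← derivSymbol_add_single]

theorem vanishesToOrder_zero (c : ScalarFilter d) : VanishesToOrder 0 c :=
  fun _ h => absurd h (Nat.not_lt_zero _)

theorem vanishesToOrder_succ {n : ℕ} {c : ScalarFilter d} :
    VanishesToOrder (n + 1) c ↔ evalHom 0 c = 0 ∧ ∀ i, VanishesToOrder n (filterDeriv i c) := by
  constructor
  · intro h
    refine ⟨?_, fun i μ hμ => ?_⟩
    · have := h 0 (by simp [deg])
      rwa [derivSymbol_zero, weight_one] at this
    · rw [← weight_derivSymbol_add_single]
      apply h
      rw [deg_add, deg_single]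
      omega
  · rintro ⟨h0, h⟩ μ hμ
    by_cases hd : deg μ = 0
    · rw [deg_eq_zero.1 hd, derivSymbol_zero, weight_one, h0]
    · obtain ⟨i, μ', rfl⟩ := exists_eq_add_single hd
      rw [weight_derivSymbol_add_single]
      apply h
      rw [deg_add, deg_single] at hμ
      omega

theorem VanishesToOrder.mono {n n' : ℕ} {c : ScalarFilter d} (h : VanishesToOrder n c)
    (hn : n' ≤ n) : VanishesToOrder n' c :=
  fun μ hμ => h μ (hμ.trans_le hn)

theorem VanishesToOrder.add {n : ℕ} {x y : ScalarFilter d} (hx : VanishesToOrder n x)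
    (hy : VanishesToOrder n y) : VanishesToOrder n (x + y) := fun μ hμ => by
  rw [map_add, map_add, hx μ hμ, hy μ hμ, add_zero]

theorem VanishesToOrder.filterDeriv {n : ℕ} {c : ScalarFilter d} (h : VanishesToOrder n c)
    (i : Fin d) : VanishesToOrder (n - 1) (filterDeriv i c) := by
  cases n with
  | zero => exact vanishesToOrder_zero _
  | succ n => exact (vanishesToOrder_succ.1 h).2 i

/-- Induction by the Leibniz rule. The inequality replaces `N = n + m` because a derivative lowers
the order by truncated subtraction: when `n = 0` the order `n - 1` does not drop, and only the
inequality survives. -/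
theorem VanishesToOrder.mul_of_le {N n m : ℕ} (hN : N ≤ n + m) {x y : ScalarFilter d}
    (hx : VanishesToOrder n x) (hy : VanishesToOrder m y) : VanishesToOrder N (x * y) := by
  induction N generalizing n m x y with
  | zero => exact vanishesToOrder_zero _
  | succ N ih =>
    rw [vanishesToOrder_succ]
    constructor
    · rw [map_mul]
      by_cases hn : n = 0
      · obtain ⟨m', rfl⟩ : ∃ m', m = m' + 1 := ⟨m - 1, by omega⟩
        rw [(vanishesToOrder_succ.1 hy).1, mul_zero]
      · obtain ⟨n', rfl⟩ : ∃ n', n = n' + 1 := ⟨n - 1, by omega⟩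
        rw [(vanishesToOrder_succ.1 hx).1, zero_mul]
    · intro i
      rw [filterDeriv_mul]
      exact (ih (by omega) (hx.filterDeriv i) hy).add (ih (by omega) hx (hy.filterDeriv i))

theorem VanishesToOrder.mul {n m : ℕ} {x y : ScalarFilter d}
    (hx : VanishesToOrder n x) (hy : VanishesToOrder m y) : VanishesToOrder (n + m) (x * y) :=
  hx.mul_of_le le_rfl hy

/-- The ideal of the scalar filters whose Fourier series vanish to order `n` at the origin. -/
def vanishingIdeal (d n : ℕ) : Ideal (ScalarFilter d) where
  carrier := {c | VanishesToOrder n c}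
  add_mem' hx hy := hx.add hy
  zero_mem' := fun μ _ => by simp
  smul_mem' c x hx := (vanishesToOrder_zero c).mul_of_le (Nat.zero_add n).ge hx

theorem mem_vanishingIdeal {n : ℕ} {c : ScalarFilter d} :
    c ∈ vanishingIdeal d n ↔
      ∀ μ : Fin d → ℕ, deg μ < n → evalHom 0 (weight (derivSymbol μ) c) = 0 := Iff.rfl

theorem vanishingIdeal_anti {n n' : ℕ} (h : n' ≤ n) : vanishingIdeal d n ≤ vanishingIdeal d n' :=
  fun _ hc => VanishesToOrder.mono hc h

theorem mul_mem_vanishingIdeal {n m : ℕ} {x y : ScalarFilter d} (hx : x ∈ vanishingIdeal d n)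
    (hy : y ∈ vanishingIdeal d m) : x * y ∈ vanishingIdeal d (n + m) :=
  VanishesToOrder.mul hx hy

theorem mem_vanishingIdeal_one {c : ScalarFilter d} :
    c ∈ vanishingIdeal d 1 ↔ evalHom 0 c = 0 := by
  change VanishesToOrder (0 + 1) c ↔ _
  rw [vanishesToOrder_succ]
  exact and_iff_left fun i => vanishesToOrder_zero _

theorem mem_vanishingIdeal_zero (c : ScalarFilter d) : c ∈ vanishingIdeal d 0 :=
  vanishesToOrder_zero c

/-- The bridge from the analytic relation to membership in an ideal. -/
theorem eqO_fourierSeries {n : ℕ} {A B : Filt d s t} :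
    EqO n (fourierSeries A) (fourierSeries B) ↔ ∀ i j, A i j - B i j ∈ vanishingIdeal d n := by
  simp only [EqO, fourierSeries_apply, mderiv_evalHom, mem_vanishingIdeal, map_sub, sub_eq_zero]

theorem upsampleHom_mem_vanishingIdeal {n N : ℕ} {c : ScalarFilter d}
    (hc : c ∈ vanishingIdeal d n) : upsampleHom d N c ∈ vanishingIdeal d n := by
  intro μ hμ
  -- Chain rule: dilation by `N` multiplies a derivative of order `|μ|` at the origin by `N^{|μ|}`.
  have : ∀ x : ScalarFilter d, evalHom 0 (weight (derivSymbol μ) (upsampleHom d N x)) =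
      (N : ℂ) ^ deg μ * evalHom 0 (weight (derivSymbol μ) x) := by
    intro x
    induction x using AddMonoidAlgebra.induction_linear with
    | zero => simp
    | add x y hx hy => simp only [map_add, mul_add, hx, hy]
    | single k b =>
      have : derivSymbol μ (N • k) = (N : ℂ) ^ deg μ * derivSymbol μ k := by
        rw [derivSymbol, derivSymbol, deg, ← Finset.prod_pow_eq_pow_sum, ← Finset.prod_mul_distrib]
        refine Finset.prod_congr rfl fun l _ => ?_
        rw [← mul_pow]
        simp only [Pi.smul_apply, nsmul_eq_mul]
        push_cast
        ring
      rw [upsampleHom_single, weight_single, weight_single, evalHom_single, evalHom_single, this]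
      simp only [PiLp.zero_apply, Complex.ofReal_zero, mul_zero, Finset.sum_const_zero, neg_zero,
        Complex.exp_zero]
      ring
  rw [this, hc μ hμ, mul_zero]

/-! ### Differences -/

theorem evalHom_zero_single (k : Fin d → ℤ) (c : ℂ) :
    evalHom 0 (AddMonoidAlgebra.single k c) = c := by
  simp [evalHom_single]

theorem nablaDelta_zero : nablaDelta (0 : Fin d → ℕ) = 1 := by
  simp [nablaDelta]

theorem nablaDelta_add (μ ν : Fin d → ℕ) :
    nablaDelta (μ + ν) = nablaDelta μ * nablaDelta ν := by
  simp [nablaDelta, pow_add, Finset.prod_mul_distrib]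

theorem nablaDelta_single (i : Fin d) :
    nablaDelta (Pi.single i 1) = 1 - AddMonoidAlgebra.single (Pi.single i 1) 1 := by
  rw [nablaDelta, Finset.prod_eq_single i]
  · simp
  · intro l _ hl
    simp [hl]
  · simp

theorem nablaDelta_mem_vanishingIdeal (ν : Fin d → ℕ) :
    nablaDelta ν ∈ vanishingIdeal d (deg ν) := by
  induction h : deg ν generalizing ν with
  | zero => exact mem_vanishingIdeal_zero _
  | succ n ih =>
    obtain ⟨i, ν', rfl⟩ := exists_eq_add_single (μ := ν) (by omega)
    rw [deg_add, deg_single] at h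
    rw [nablaDelta_add]
    refine mul_mem_vanishingIdeal (ih ν' (by omega)) (mem_vanishingIdeal_one.2 ?_)
    rw [nablaDelta_single, map_sub, map_one, evalHom_zero_single, sub_self]

theorem filterDeriv_one (i : Fin d) : filterDeriv i (1 : ScalarFilter d) = 0 := by
  rw [AddMonoidAlgebra.one_def, filterDeriv, weight_single]
  simp

theorem filterDeriv_nablaDelta_single (i j : Fin d) :
    filterDeriv i (nablaDelta (Pi.single j 1)) =
      if i = j then AddMonoidAlgebra.single (Pi.single i 1) Complex.I else 0 := by
  rw [nablaDelta_single, map_sub, filterDeriv_one, filterDeriv, weight_single, zero_sub,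
    ← AddMonoidAlgebra.single_neg]
  by_cases h : i = j
  · subst h
    simp
  · simp [h]

/-- `∂_i ∇^ν δ = i ν_i ∇^{ν - ε_i} δ(· - ε_i)`. -/
theorem filterDeriv_nablaDelta (i : Fin d) (ν : Fin d → ℕ) :
    filterDeriv i (nablaDelta ν) = (ν i : ℂ) • (nablaDelta (ν - Pi.single i 1) *
      AddMonoidAlgebra.single (Pi.single i 1) Complex.I) := by
  induction h : deg ν generalizing ν with
  | zero => rw [deg_eq_zero.1 h, nablaDelta_zero, filterDeriv_one]; simp
  | succ n ih =>
    obtain ⟨j, ν', rfl⟩ := exists_eq_add_single (μ := ν) (by omega)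
    rw [deg_add, deg_single] at h
    rw [nablaDelta_add, filterDeriv_mul, ih ν' (by omega), filterDeriv_nablaDelta_single]
    by_cases hij : i = j
    · subst hij
      rw [if_pos rfl, add_tsub_cancel_right]
      have h1 : (ν' i : ℂ) • (nablaDelta (ν' - Pi.single i 1) *
          AddMonoidAlgebra.single (Pi.single i 1) Complex.I) * nablaDelta (Pi.single i 1) =
          (ν' i : ℂ) • (nablaDelta ν' * AddMonoidAlgebra.single (Pi.single i 1) Complex.I) := by
        by_cases h0 : ν' i = 0
        · simp [h0]
        · have : nablaDelta ν' = nablaDelta (ν' - Pi.single i 1) * nablaDelta (Pi.single i 1) := by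
            rw [← nablaDelta_add]
            congr 1
            funext l
            by_cases hl : l = i
            · subst hl
              simp only [Pi.add_apply, Pi.sub_apply, Pi.single_eq_same]
              omega
            · simp [hl]
          rw [this, smul_mul_assoc]
          congr 1
          ring
      rw [h1]
      simp only [Pi.add_apply, Pi.single_eq_same, Nat.cast_add, Nat.cast_one, add_smul, one_smul]
    · have h2 : ν' + Pi.single j 1 - Pi.single i 1 = ν' - Pi.single i 1 + Pi.single j 1 := by
        funext l
        by_cases hl : l = i
        · subst hl
          simp [hij]
        · simp [hl]
      rw [if_neg hij, mul_zero, add_zero, h2, nablaDelta_add]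
      simp only [Pi.add_apply, ne_eq, hij, not_false_eq_true, Pi.single_eq_of_ne, add_zero,
        smul_mul_assoc]
      congr 1
      ring

/-- The moments of order `|ν|` of `∇^ν δ`. -/
theorem moment_nablaDelta {μ ν : Fin d → ℕ} (h : deg μ = deg ν) :
    evalHom 0 (weight (derivSymbol μ) (nablaDelta ν)) =
      if μ = ν then Complex.I ^ deg μ * ∏ i, ((μ i).factorial : ℂ) else 0 := by
  induction hn : deg μ generalizing μ ν with
  | zero =>
    have h1 := deg_eq_zero.1 hn
    have h2 := deg_eq_zero.1 (h.symm.trans hn)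
    subst h1 h2
    simp [derivSymbol_zero, weight_one, nablaDelta_zero]
  | succ n ih =>
    obtain ⟨i, μ', rfl⟩ := exists_eq_add_single (μ := μ) (by omega)
    rw [weight_derivSymbol_add_single, filterDeriv_nablaDelta, map_smul, map_smul]
    rw [deg_add, deg_single] at hn h
    by_cases h0 : ν i = 0
    · have hne : μ' + Pi.single i 1 ≠ ν := by
        rintro rfl
        simp at h0
      rw [if_neg hne, h0, Nat.cast_zero, zero_smul]
    · obtain ⟨ν', rfl⟩ : ∃ ν' : Fin d → ℕ, ν = ν' + Pi.single i 1 := by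
        refine ⟨ν - Pi.single i 1, ?_⟩
        funext l
        by_cases hl : l = i
        · subst hl
          simp only [Pi.add_apply, Pi.sub_apply, Pi.single_eq_same]
          omega
        · simp [hl]
      rw [deg_add, deg_single] at h
      -- The shift left by the differentiation is `δ - ∇_i δ`. The term with the extra difference
      -- vanishes to an order higher than `|μ'|`, so it contributes nothing.
      have h3 : nablaDelta ν' * AddMonoidAlgebra.single (Pi.single i 1) Complex.I =
          Complex.I • nablaDelta ν' - Complex.I • nablaDelta (ν' + Pi.single i 1) := by
        rw [nablaDelta_add, nablaDelta_single, mul_sub, mul_one, smul_sub, sub_sub_cancel,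
          ← mul_smul_comm, AddMonoidAlgebra.smul_single, smul_eq_mul, mul_one]
      have h4 := nablaDelta_mem_vanishingIdeal (ν' + Pi.single i 1) μ'
        (by rw [deg_add, deg_single]; omega)
      rw [add_tsub_cancel_right, h3]
      simp only [map_sub, map_smul, h4, ih (μ := μ') (ν := ν') (by omega) (by omega)]
      by_cases hμν : μ' = ν'
      · subst hμν
        have h5 : ∏ l, (((μ' + Pi.single i 1 : Fin d → ℕ) l).factorial : ℂ) =
            (μ' i + 1) * ∏ l, ((μ' l).factorial : ℂ) := by
          rw [← Finset.mul_prod_erase Finset.univ _ (Finset.mem_univ i),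
            ← Finset.mul_prod_erase Finset.univ (fun l => ((μ' l).factorial : ℂ))
              (Finset.mem_univ i), ← mul_assoc]
          congr 1
          · simp [Nat.factorial_succ]
          · refine Finset.prod_congr rfl fun l hl => ?_
            simp [Finset.ne_of_mem_erase hl]
        rw [if_pos rfl, if_pos rfl, h5]
        simp only [Pi.add_apply, Pi.single_eq_same, Nat.cast_add, Nat.cast_one, smul_eq_mul,
          mul_zero, sub_zero, pow_succ]
        ring
      · simp [hμν]

/-- `∇^ν δ`, `|ν| = j`, span the ideal of the filters that vanish to order `j`. -/
noncomputable def nablaIdeal (d j : ℕ) : Ideal (ScalarFilter d) :=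
  Ideal.span {c | ∃ ν : Fin d → ℕ, deg ν = j ∧ c = nablaDelta ν}

theorem nablaDelta_mem_nablaIdeal (ν : Fin d → ℕ) : nablaDelta ν ∈ nablaIdeal d (deg ν) :=
  Ideal.subset_span ⟨ν, rfl, rfl⟩

theorem nablaIdeal_le_vanishingIdeal (d j : ℕ) : nablaIdeal d j ≤ vanishingIdeal d j := by
  rw [nablaIdeal, Ideal.span_le]
  rintro _ ⟨ν, rfl, rfl⟩
  exact nablaDelta_mem_vanishingIdeal ν

/-- Modulo first differences each unit shift becomes 1. As `k ↦` (class of the shift by `k`) is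
multiplicative, all shifts become 1. -/
theorem single_sub_one_mem_nablaIdeal (k : Fin d → ℤ) :
    AddMonoidAlgebra.single k 1 - 1 ∈ nablaIdeal d 1 := by
  let φ : Multiplicative (Fin d → ℤ) →* ScalarFilter d ⧸ nablaIdeal d 1 :=
    (Ideal.Quotient.mk (nablaIdeal d 1)).toMonoidHom.comp (AddMonoidAlgebra.of ℂ (Fin d → ℤ))
  have hφ : ∀ k : Fin d → ℤ, φ (Multiplicative.ofAdd k) =
    Ideal.Quotient.mk (nablaIdeal d 1) (AddMonoidAlgebra.single k 1) := fun _ => rfl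
  have h1 : ∀ i : Fin d, φ (Multiplicative.ofAdd (Pi.single i 1)) = 1 := by
    intro i
    rw [hφ, ← map_one (Ideal.Quotient.mk _), Ideal.Quotient.eq, ← neg_mem_iff, neg_sub,
      ← nablaDelta_single]
    have := nablaDelta_mem_nablaIdeal (Pi.single i 1 : Fin d → ℕ)
    rwa [deg_single] at this
  have h2 : ∀ k : Fin d → ℤ, φ (Multiplicative.ofAdd k) = 1 := by
    intro k
    have hk : k = ∑ i, k i • (Pi.single i 1 : Fin d → ℤ) := by
      funext l
      simp [Finset.sum_apply, Pi.single_apply]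
    rw [hk, ofAdd_sum, map_prod]
    refine Finset.prod_eq_one fun i _ => ?_
    rw [ofAdd_zsmul]
    have : ∀ n : ℤ, φ (Multiplicative.ofAdd (Pi.single i 1 : Fin d → ℤ) ^ n) = 1 := by
      intro n
      obtain ⟨n, rfl | rfl⟩ := n.eq_nat_or_neg
      · rw [zpow_natCast, map_pow, h1, one_pow]
      · have h3 : φ (Multiplicative.ofAdd (Pi.single i 1 : Fin d → ℤ) ^ (-(n : ℤ))) *
            φ (Multiplicative.ofAdd (Pi.single i 1 : Fin d → ℤ) ^ n) = 1 := by
          rw [← map_mul, zpow_neg, zpow_natCast, inv_mul_cancel, map_one]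
        rwa [map_pow φ, h1, one_pow, mul_one] at h3
    exact this _
  rw [← Ideal.Quotient.eq, ← hφ, h2, map_one]

/-- Modulo first differences a filter is the sum of its coefficients. -/
theorem sub_algebraMap_mem_nablaIdeal (x : ScalarFilter d) :
    x - algebraMap ℂ (ScalarFilter d) (evalHom 0 x) ∈ nablaIdeal d 1 := by
  induction x using AddMonoidAlgebra.induction_linear with
  | zero => simp
  | add x y hx hy =>
    rw [map_add, map_add, add_sub_add_comm]
    exact add_mem hx hy
  | single k b =>
    have : AddMonoidAlgebra.single k b - algebraMap ℂ (ScalarFilter d) b =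
        algebraMap ℂ (ScalarFilter d) b * (AddMonoidAlgebra.single k 1 - 1) := by
      rw [← Algebra.smul_def, smul_sub, AddMonoidAlgebra.smul_single, smul_eq_mul, mul_one,
        Algebra.algebraMap_eq_smul_one]
    rw [evalHom_zero_single, this]
    exact Ideal.mul_mem_left _ _ (single_sub_one_mem_nablaIdeal k)

theorem mul_mem_nablaIdeal {i j : ℕ} {x y : ScalarFilter d} (hx : x ∈ nablaIdeal d i)
    (hy : y ∈ nablaIdeal d j) : x * y ∈ nablaIdeal d (i + j) := by
  have : nablaIdeal d i * nablaIdeal d j ≤ nablaIdeal d (i + j) := by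
    rw [nablaIdeal, nablaIdeal, Ideal.span_mul_span', Ideal.span_le]
    rintro _ ⟨_, ⟨μ, rfl, rfl⟩, _, ⟨ν, rfl, rfl⟩, rfl⟩
    change nablaDelta μ * nablaDelta ν ∈ _
    rw [← nablaDelta_add, ← deg_add]
    exact nablaDelta_mem_nablaIdeal _
  exact this (Ideal.mul_mem_mul hx hy)

/-- The multi-indices of degree `j`. -/
def multiIndices (d j : ℕ) : Finset (Fin d → ℕ) := Finset.piAntidiag Finset.univ j

theorem mem_multiIndices {j : ℕ} {μ : Fin d → ℕ} : μ ∈ multiIndices d j ↔ deg μ = j := by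
  simp [multiIndices, deg]

theorem factor_ne_zero (μ : Fin d → ℕ) :
    Complex.I ^ deg μ * ∏ i, ((μ i).factorial : ℂ) ≠ 0 := by
  refine mul_ne_zero (pow_ne_zero _ Complex.I_ne_zero) (Finset.prod_ne_zero_iff.2 ?_)
  intro i _
  exact_mod_cast (μ i).factorial_ne_zero

/-- Taylor expansion in terms of differences, in the lowest order. -/
theorem exists_sub_sum_mem_nablaIdeal {j : ℕ} {c : ScalarFilter d} (hc : c ∈ nablaIdeal d j) :
    ∃ b : (Fin d → ℕ) → ℂ,
      c - ∑ ν ∈ multiIndices d j, b ν • nablaDelta ν ∈ nablaIdeal d (j + 1) := by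
  rw [nablaIdeal, Ideal.span] at hc
  induction hc using Submodule.span_induction with
  | mem x hx =>
    obtain ⟨ν, rfl, rfl⟩ := hx
    refine ⟨fun ν' => if ν' = ν then 1 else 0, ?_⟩
    simp [mem_multiIndices]
  | zero => exact ⟨0, by simp⟩
  | add x y _ _ hx hy =>
    obtain ⟨b, hb⟩ := hx
    obtain ⟨b', hb'⟩ := hy
    refine ⟨b + b', ?_⟩
    simp only [Pi.add_apply, add_smul, Finset.sum_add_distrib, add_sub_add_comm]
    exact add_mem hb hb'
  | smul z x hx' hx =>
    obtain ⟨b, hb⟩ := hx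
    -- To leading order the factor `z` acts as its value at the origin; the error is a product of a
    -- first difference and an element of order `j`.
    refine ⟨fun ν => evalHom 0 z * b ν, ?_⟩
    have h1 := mul_mem_nablaIdeal (sub_algebraMap_mem_nablaIdeal z) hx'
    have h2 := Ideal.mul_mem_left _ (algebraMap ℂ (ScalarFilter d) (evalHom 0 z)) hb
    rw [add_comm] at h1
    convert add_mem h1 h2 using 1
    rw [mul_sub, ← Algebra.smul_def, ← Algebra.smul_def, Finset.smul_sum, sub_mul,
      ← Algebra.smul_def, smul_eq_mul]
    simp only [mul_smul]
    ring

/-- By induction, a filter vanishing to order `j + 1` is a combination `∑ b ν • ∇^ν δ` over `deg ν =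
j`, modulo differences of order `j + 1`. The combination then vanishes to order `j + 1` too, and
since the moments of order `j` of these differences form an invertible diagonal matrix, every `b ν •
∇^ν δ` is zero. -/
theorem vanishingIdeal_eq_nablaIdeal (d j : ℕ) : vanishingIdeal d j = nablaIdeal d j := by
  refine le_antisymm ?_ (nablaIdeal_le_vanishingIdeal d j)
  induction j with
  | zero =>
    intro c _
    have h : (1 : ScalarFilter d) ∈ nablaIdeal d 0 := by
      have := nablaDelta_mem_nablaIdeal (0 : Fin d → ℕ)
      rwa [nablaDelta_zero, show deg (0 : Fin d → ℕ) = 0 by simp [deg]] at this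
    simpa using Ideal.mul_mem_left _ c h
  | succ j ih =>
    intro c hc
    obtain ⟨b, hb⟩ := exists_sub_sum_mem_nablaIdeal (ih (vanishingIdeal_anti (Nat.le_succ j) hc))
    have h1 := sub_mem hc (nablaIdeal_le_vanishingIdeal _ _ hb)
    rw [sub_sub_cancel] at h1
    have h2 : ∑ ν ∈ multiIndices d j, b ν • nablaDelta ν = 0 := by
      refine Finset.sum_eq_zero fun μ hμ => ?_
      rw [mem_multiIndices] at hμ
      have h3 := h1 μ (by omega)
      simp only [map_sum, map_smul] at h3
      rw [Finset.sum_eq_single μ] at h3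
      · rw [moment_nablaDelta rfl, if_pos rfl, smul_eq_mul] at h3
        rw [(mul_eq_zero.1 h3).resolve_right (factor_ne_zero μ), zero_smul]
      · intro ν hν hne
        rw [mem_multiIndices] at hν
        rw [moment_nablaDelta (by omega), if_neg hne.symm, smul_zero]
      · intro h
        exact absurd (mem_multiIndices.2 hμ) h
    rwa [h2, sub_zero] at hb

/-! ### Derivatives of monomials -/

/-- The truncated exponent is harmless: when `μ i = 0` the factor `μ i` already vanishes. -/
theorem pderiv_monomial (i : Fin d) (c : ℂ) (μ : Fin d → ℕ) :
    pderiv i (fun ξ : Rd d => c * ∏ l, (Complex.I * (ξ l : ℂ)) ^ μ l) =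
      fun ξ => (c * Complex.I * (μ i : ℂ)) *
        ∏ l, (Complex.I * (ξ l : ℂ)) ^ (μ l - if l = i then 1 else 0) := by
  funext ξ
  refine HasLineDerivAt.lineDeriv ?_
  have hline : ∀ τ : ℝ, c * ∏ l, (Complex.I *
        (((ξ + τ • EuclideanSpace.single i (1 : ℝ) : Rd d) l : ℝ) : ℂ)) ^ μ l =
      c * (∏ l ∈ Finset.univ.erase i, (Complex.I * (ξ l : ℂ)) ^ μ l) *
        (Complex.I * ((ξ i : ℂ) + (τ : ℂ))) ^ μ i := by
    intro τ
    rw [← Finset.mul_prod_erase Finset.univ _ (Finset.mem_univ i), mul_comm (_ ^ _), ← mul_assoc]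
    congr 2
    · refine Finset.prod_congr rfl fun l hl => ?_
      simp [Finset.ne_of_mem_erase hl]
    · simp
  simp only [HasLineDerivAt, hline]
  have h1 : HasDerivAt (fun τ : ℝ => Complex.I * ((ξ i : ℂ) + (τ : ℂ))) (Complex.I * 1) 0 :=
    ((Complex.ofRealCLM.hasDerivAt (x := (0 : ℝ))).const_add _).const_mul _
  refine ((h1.pow (μ i)).const_mul _).congr_deriv ?_
  rw [← Finset.mul_prod_erase Finset.univ (fun l => (Complex.I * (ξ l : ℂ)) ^
    (μ l - if l = i then 1 else 0)) (Finset.mem_univ i)]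
  have h2 : ∏ l ∈ Finset.univ.erase i, (Complex.I * (ξ l : ℂ)) ^ (μ l - if l = i then 1 else 0) =
      ∏ l ∈ Finset.univ.erase i, (Complex.I * (ξ l : ℂ)) ^ μ l := by
    refine Finset.prod_congr rfl fun l hl => ?_
    simp [Finset.ne_of_mem_erase hl]
  rw [h2]
  simp only [Complex.ofReal_zero, add_zero, if_true, mul_one]
  ring

theorem iterate_pderiv_monomial (i : Fin d) (n : ℕ) (c : ℂ) (μ : Fin d → ℕ) :
    (pderiv i)^[n] (fun ξ : Rd d => c * ∏ l, (Complex.I * (ξ l : ℂ)) ^ μ l) =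
      fun ξ => (c * (Complex.I ^ n * ((μ i).descFactorial n : ℂ))) *
        ∏ l, (Complex.I * (ξ l : ℂ)) ^ (μ l - if l = i then n else 0) := by
  induction n generalizing c μ with
  | zero => simp
  | succ n ih =>
    rw [Function.iterate_succ_apply, pderiv_monomial, ih]
    funext ξ
    congr 1
    · rw [if_pos rfl]
      have : (μ i).descFactorial (n + 1) = μ i * (μ i - 1).descFactorial n := by
        cases h : μ i with
        | zero => simp
        | succ q => rw [Nat.succ_descFactorial_succ]; rfl
      rw [this]
      push_cast
      ring
    · refine Finset.prod_congr rfl fun l _ => ?_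
      by_cases hl : l = i
      · simp only [hl, if_true]
        rw [Nat.sub_sub, add_comm]
      · simp [hl]

theorem mderiv_monomial (ν : Fin d → ℕ) (c : ℂ) (μ : Fin d → ℕ) :
    mderiv ν (fun ξ : Rd d => c * ∏ l, (Complex.I * (ξ l : ℂ)) ^ μ l) 0 =
      if ν = μ then c * (Complex.I ^ deg μ * ∏ i, ((μ i).factorial : ℂ)) else 0 := by
  have hL : ∀ L : List (Fin d), L.Nodup →
      L.foldr (fun i g => (pderiv i)^[ν i] g)
        (fun ξ : Rd d => c * ∏ l, (Complex.I * (ξ l : ℂ)) ^ μ l) =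
      fun ξ => (c * (L.map fun i => Complex.I ^ ν i * ((μ i).descFactorial (ν i) : ℂ)).prod) *
        ∏ l, (Complex.I * (ξ l : ℂ)) ^ (μ l - if l ∈ L then ν l else 0) := by
    intro L hnd
    induction L with
    | nil => simp
    | cons i L ih =>
      rw [List.nodup_cons] at hnd
      rw [List.foldr_cons, ih hnd.2, iterate_pderiv_monomial]
      funext ξ
      congr 1
      · rw [if_neg hnd.1, List.map_cons, List.prod_cons, Nat.sub_zero]
        ring
      · refine Finset.prod_congr rfl fun l _ => ?_
        by_cases hl : l = i
        · subst hl
          simp [hnd.1]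
        · simp [hl]
  rw [mderiv, hL _ (List.nodup_finRange d)]
  simp only [List.mem_finRange, if_true, PiLp.zero_apply, Complex.ofReal_zero, mul_zero]
  rw [← Fin.prod_univ_def fun i => Complex.I ^ ν i * ((μ i).descFactorial (ν i) : ℂ)]
  by_cases h : ν = μ
  · subst h
    simp only [Nat.sub_self, pow_zero, Finset.prod_const_one, mul_one, Nat.descFactorial_self,
      if_true, Finset.prod_mul_distrib, Finset.prod_pow_eq_pow_sum, deg]
  · rw [if_neg h]
    obtain ⟨i, hi⟩ := Function.ne_iff.1 h
    -- Too few derivatives in direction `i` leave a positive power of 0; too many make the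
    -- descending factorial vanish.
    rcases lt_or_gt_of_ne hi with hlt | hgt
    · rw [Finset.prod_eq_zero (f := fun l => (0 : ℂ) ^ (μ l - ν l)) (Finset.mem_univ i)
        (zero_pow (by omega)), mul_zero]
    · rw [Finset.prod_eq_zero (f := fun l => Complex.I ^ ν l * ((μ l).descFactorial (ν l) : ℂ))
        (Finset.mem_univ i) (by rw [Nat.descFactorial_of_lt hgt]; simp), mul_zero, zero_mul]

/-! ### Moment spaces and sum rules in terms of filters -/

/-- The moment of order `μ` of a scalar filter. -/
noncomputable def moment (μ : Fin d → ℕ) (c : ScalarFilter d) : ℂ :=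
  evalHom 0 (weight (derivSymbol μ) c)

theorem mem_V_iff {j : ℕ} {y : Filt d 1 r} {w : Filt d r 1} :
    w ∈ V j y ↔ (y * w) 0 0 ∈ vanishingIdeal d j := by
  have h0 : (fun _ : Rd d => (0 : Matrix (Fin 1) (Fin 1) ℂ)) =
      fourierSeries (0 : Filt d 1 1) := by
    funext ξ
    ext i j
    simp [fourierSeries_apply]
  change EqO _ _ _ ↔ _
  simp only [← fourierSeries_mul]
  rw [h0, eqO_fourierSeries]
  simp

theorem beta_eq (y : Filt d 1 r) (u : Filt d r 1) (μ : Fin d → ℕ) :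
    beta y u μ = moment μ ((y * u) 0 0) / (Complex.I ^ deg μ * ∏ i, ((μ i).factorial : ℂ)) := by
  rw [beta]
  simp only [← fourierSeries_mul, fourierSeries_apply, mderiv_evalHom]
  rfl

/-- `beta` is normalized so that the condition at `ν = μ` is automatic, and the monomial has no
other nonzero derivative at 0. What remains is the vanishing of the other moments. -/
theorem mem_M_iff {y : Filt d 1 r} {μ : Fin d → ℕ} {u : Filt d r 1} :
    u ∈ M y μ ↔ ∀ ν, deg ν ≤ deg μ → ν ≠ μ → moment ν ((y * u) 0 0) = 0 := by
  change EqO _ _ _ ↔ _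
  simp only [← fourierSeries_mul, EqO, Matrix.of_apply, fourierSeries_apply, mderiv_evalHom,
    mderiv_monomial, Nat.lt_succ_iff, Fin.forall_fin_one]
  refine forall_congr' fun ν => forall_congr' fun _ => ?_
  by_cases h : ν = μ
  · subst h
    rw [if_pos rfl, beta_eq, div_mul_cancel₀ _ (factor_ne_zero ν)]
    simp [moment]
  · simp [h, moment]

/-- Dilation and shift of the argument are moved onto the filters, so that sum rules become
congruences modulo an ideal. -/
theorem sumRules_iff {lam n : ℕ} {a : Filt d r r} {y : Filt d 1 r} :
    SumRules lam n a y ↔ fourierSeries y 0 ≠ 0 ∧ ∀ ω ∈ Omega d lam, ∀ j,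
      (upsample lam y * modulate ((2 * Real.pi) • ω) a) 0 j - (if ω = 0 then y 0 j else 0) ∈
        vanishingIdeal d n := by
  classical
  have key : ∀ ω : Rd d,
      EqO n (fun ξ => fourierSeries y ((lam : ℝ) • ξ) * fourierSeries a (ξ + (2 * Real.pi) • ω))
        (fun ξ => (if ω = 0 then (1 : ℂ) else 0) • fourierSeries y ξ) ↔
      ∀ j, (upsample lam y * modulate ((2 * Real.pi) • ω) a) 0 j - (if ω = 0 then y 0 j else 0) ∈
        vanishingIdeal d n := by
    intro ω
    simp only [← fourierSeries_upsample, ← fourierSeries_modulate, ← fourierSeries_mul,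
      ← fourierSeries_smul]
    rw [eqO_fourierSeries]
    simp only [Fin.forall_fin_one]
    refine forall_congr' fun j => ?_
    by_cases h : ω = 0 <;> simp [h]
  rw [SumRules]
  refine and_congr_right fun _ => forall_congr' fun ω => forall_congr' fun _ => ?_
  convert key ω

theorem mul_entry_mem_left {q : ℕ} {J : Ideal (ScalarFilter d)} {A : Filt d s t} {B : Filt d t q}
    (h : ∀ i j, A i j ∈ J) (i : Fin s) (j : Fin q) : (A * B) i j ∈ J := by
  rw [Matrix.mul_apply]
  exact sum_mem fun l _ => Ideal.mul_mem_right _ _ (h i l)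

/-- `ŷ = ŷ' + O(‖ξ‖^n)` for row filters. -/
def RowEqO (n : ℕ) (y y' : Filt d 1 r) : Prop :=
  ∀ i j, (y - y') i j ∈ vanishingIdeal d n

theorem RowEqO.symm {n : ℕ} {y y' : Filt d 1 r} (h : RowEqO n y y') : RowEqO n y' y := by
  intro i j
  rw [← neg_sub, Matrix.neg_apply]
  exact neg_mem (h i j)

theorem RowEqO.mono {n n' : ℕ} {y y' : Filt d 1 r} (h : RowEqO n y y') (hn : n' ≤ n) :
    RowEqO n' y y' :=
  fun i j => vanishingIdeal_anti hn (h i j)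

theorem RowEqO.mul_sub_mem {n : ℕ} {y y' : Filt d 1 r} (h : RowEqO n y y') (w : Filt d r s)
    (i : Fin 1) (j : Fin s) : (y * w) i j - (y' * w) i j ∈ vanishingIdeal d n := by
  rw [← Matrix.sub_apply, ← Matrix.sub_mul]
  exact mul_entry_mem_left h i j

theorem RowEqO.V_eq {n : ℕ} {y y' : Filt d 1 r} (h : RowEqO n y y') : V n y = V n y' := by
  ext w
  rw [mem_V_iff, mem_V_iff]
  exact (Ideal.add_mem_iff_right _ (h.mul_sub_mem w 0 0)).symm.trans (by rw [sub_add_cancel]) |>.symm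

theorem RowEqO.moment_eq {n : ℕ} {y y' : Filt d 1 r} (h : RowEqO n y y') {μ : Fin d → ℕ}
    (hμ : deg μ < n) (w : Filt d r 1) : moment μ ((y * w) 0 0) = moment μ ((y' * w) 0 0) := by
  have := h.mul_sub_mem w 0 0 μ hμ
  rwa [map_sub, map_sub, sub_eq_zero] at this

theorem RowEqO.M_eq {n : ℕ} {y y' : Filt d 1 r} (h : RowEqO n y y') {μ : Fin d → ℕ}
    (hμ : deg μ < n) : M y μ = M y' μ := by
  ext w
  rw [mem_M_iff, mem_M_iff]
  refine forall_congr' fun ν => forall_congr' fun hν => ?_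
  rw [h.moment_eq (hν.trans_lt hμ)]

theorem RowEqO.beta_eq {n : ℕ} {y y' : Filt d 1 r} (h : RowEqO n y y') {μ : Fin d → ℕ}
    (hμ : deg μ < n) (w : Filt d r 1) : beta y w μ = beta y' w μ := by
  rw [VecSubdivision.beta_eq, VecSubdivision.beta_eq, h.moment_eq hμ]

theorem RowEqO.fourierSeries_zero_eq {n : ℕ} {y y' : Filt d 1 r} (h : RowEqO n y y')
    (hn : 0 < n) : fourierSeries y 0 = fourierSeries y' 0 := by
  ext i j
  have := mem_vanishingIdeal_one.1 (vanishingIdeal_anti hn (h i j))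
  rwa [Matrix.sub_apply, map_sub, sub_eq_zero, ← fourierSeries_apply, ← fourierSeries_apply] at this

/-- Upsampling preserves the vanishing order, so both sides change by elements of the ideal.
Positivity of `n` serves to carry over the condition at the origin. -/
theorem SumRules.congr {lam n : ℕ} {a : Filt d r r} {y y' : Filt d 1 r} (hy : SumRules lam n a y)
    (hn : 0 < n) (h : RowEqO n y y') : SumRules lam n a y' := by
  rw [sumRules_iff] at hy ⊢
  refine ⟨h.fourierSeries_zero_eq hn ▸ hy.1, fun ω hω j => ?_⟩
  have h1 : RowEqO n (upsample lam y) (upsample lam y') := by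
    intro i j
    have := upsampleHom_mem_vanishingIdeal (N := lam) (h i j)
    rw [Matrix.sub_apply, map_sub] at this
    exact this
  have h2 : (if ω = 0 then y 0 j else 0) - (if ω = 0 then y' 0 j else 0) ∈ vanishingIdeal d n := by
    split_ifs
    · exact h 0 j
    · simp
  have h3 := add_mem (sub_mem (hy.2 ω hω j) (h1.mul_sub_mem (modulate ((2 * Real.pi) • ω) a) 0 j)) h2
  convert h3 using 1
  ring

/-! ### Change of the filter by a strongly invertible filter -/

/-- `U` is invertible with inverse `W`, and `U` conjugates the filter `a` to the filter
`a'`: `â'(ξ) = Û(lam ξ)⁻¹ â(ξ) Û(ξ)`. -/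
structure Conjugates (lam : ℕ) (U W a a' : Filt d r r) : Prop where
  mul_inv : U * W = 1
  inv_mul : W * U = 1
  comm : a * U = upsample lam U * a'

theorem Conjugates.of_inverse {lam : ℕ} {U W : Filt d r r} (h : U * W = 1) (h' : W * U = 1)
    (a : Filt d r r) : Conjugates lam U W a (upsample lam W * a * U) where
  mul_inv := h
  inv_mul := h'
  comm := by
    rw [← Matrix.mul_assoc, ← Matrix.mul_assoc, ← upsample_mul, h, upsample_one, Matrix.one_mul]

/-- The relation is multiplied by the upsampled `W` on the left and by `W` on the right. This
symmetry upgrades the later inequalities and implications to equalities and equivalences. -/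
theorem Conjugates.symm {lam : ℕ} {U W a a' : Filt d r r} (h : Conjugates lam U W a a') :
    Conjugates lam W U a' a where
  mul_inv := h.inv_mul
  inv_mul := h.mul_inv
  comm := by
    have : upsample lam W * (a * U) * W = upsample lam W * (upsample lam U * a') * W := by
      rw [h.comm]
    rw [Matrix.mul_assoc, Matrix.mul_assoc, h.mul_inv, Matrix.mul_one, ← Matrix.mul_assoc,
      ← upsample_mul, h.inv_mul, upsample_one, Matrix.one_mul] at this
    exact this.symm

theorem Conjugates.mul_mul_cancel {lam : ℕ} {U W a a' : Filt d r r}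
    (h : Conjugates lam U W a a') (y : Filt d s r) : y * U * W = y := by
  rw [Matrix.mul_assoc, h.mul_inv, Matrix.mul_one]

theorem Conjugates.sumRules {lam n : ℕ} {U W a a' : Filt d r r} (h : Conjugates lam U W a a')
    (hlam : lam ≠ 0) {y : Filt d 1 r} (hy : SumRules lam n a y) : SumRules lam n a' (y * U) := by
  rw [sumRules_iff] at hy ⊢
  constructor
  · intro h0
    apply hy.1
    rw [← h.mul_mul_cancel y, fourierSeries_mul, h0, Matrix.zero_mul]
  · intro ω hω j
    -- The upsampled `U` is unchanged by modulation, so it can be merged with the modulated `a'` and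
    -- the intertwining relation used inside the modulation.
    have h1 : upsample lam (y * U) * modulate ((2 * Real.pi) • ω) a' =
        upsample lam y * modulate ((2 * Real.pi) • ω) a * modulate ((2 * Real.pi) • ω) U := by
      rw [upsample_mul, Matrix.mul_assoc, ← modulate_upsample hlam hω U, ← modulate_mul, ← h.comm,
        modulate_mul, Matrix.mul_assoc]
    by_cases h0 : ω = 0
    · subst h0
      have h2 := hy.2 0 hω
      simp only [if_true] at h2 ⊢
      rw [h1]
      have h3 : RowEqO n (upsample lam y * modulate ((2 * Real.pi) • (0 : Rd d)) a) y := by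
        intro i j
        rw [Fin.fin_one_eq_zero i]
        exact h2 j
      have h4 := h3.mul_sub_mem (modulate ((2 * Real.pi) • (0 : Rd d)) U) 0 j
      rwa [smul_zero, modulate_zero U] at h4 ⊢
    · have h2 := hy.2 ω hω
      simp only [if_neg h0, sub_zero] at h2 ⊢
      rw [h1]
      refine mul_entry_mem_left (fun i l => ?_) 0 j
      rw [Fin.fin_one_eq_zero i]
      exact h2 l

theorem Conjugates.sumRules_iff {lam n : ℕ} {U W a a' : Filt d r r}
    (h : Conjugates lam U W a a') (hlam : lam ≠ 0) {y : Filt d 1 r} :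
    SumRules lam n a' (y * U) ↔ SumRules lam n a y := by
  refine ⟨fun hy => ?_, h.sumRules hlam⟩
  have := h.symm.sumRules hlam hy
  rwa [h.mul_mul_cancel] at this

theorem mul_mem_V_iff {j : ℕ} {U : Filt d r r} {y : Filt d 1 r} {w : Filt d r 1} :
    U * w ∈ V j y ↔ w ∈ V j (y * U) := by
  rw [mem_V_iff, mem_V_iff, Matrix.mul_assoc]

theorem mul_mem_M_iff {U : Filt d r r} {y : Filt d 1 r} {w : Filt d r 1} {μ : Fin d → ℕ} :
    U * w ∈ M y μ ↔ w ∈ M (y * U) μ := by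
  rw [mem_M_iff, mem_M_iff, Matrix.mul_assoc]

theorem beta_mul (y : Filt d 1 r) (U : Filt d r r) (w : Filt d r 1) (μ : Fin d → ℕ) :
    beta y (U * w) μ = beta (y * U) w μ := by
  rw [beta_eq, beta_eq, Matrix.mul_assoc]

theorem bijOn_mul {U W : Filt d r r} (h : U * W = 1) (h' : W * U = 1) {P Q : Set (Filt d r 1)}
    (hPQ : ∀ w : Filt d r 1, U * w ∈ P ↔ w ∈ Q) : Set.BijOn (fun w : Filt d r 1 => U * w) Q P := by
  refine ⟨fun w hw => (hPQ w).2 hw, fun w _ w' _ hww' => ?_, fun w hw => ⟨W * w, ?_, ?_⟩⟩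
  · have : W * (U * w) = W * (U * w') := congrArg (fun v : Filt d r 1 => W * v) hww'
    rwa [← Matrix.mul_assoc, ← Matrix.mul_assoc, h', Matrix.one_mul, Matrix.one_mul] at this
  · rw [← hPQ, ← Matrix.mul_assoc, h, Matrix.one_mul]
    exact hw
  · change U * (W * w) = w
    rw [← Matrix.mul_assoc, h, Matrix.one_mul]

/-! ### Generators -/

theorem rowE1_mul_apply [NeZero r] (w : Filt d r 1) : (rowE1 d r * w) 0 0 = w 0 0 := by
  rw [Matrix.mul_apply, Finset.sum_eq_single 0]
  · simp [rowE1]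
  · intro l _ hl
    simp [rowE1, hl]
  · simp

theorem smul_colFilter (c x : ScalarFilter d) (l : Fin r) :
    c • colFilter x l = colFilter (c * x) l := by
  ext1 i j
  by_cases h : i = l <;> simp [colFilter, h]

theorem colFilter_add (x y : ScalarFilter d) (l : Fin r) :
    colFilter (x + y) l = colFilter x l + colFilter y l := by
  ext1 i j
  by_cases h : i = l <;> simp [colFilter, h]

theorem sum_colFilter (w : Filt d r 1) : ∑ l, colFilter (w l 0) l = w := by
  ext1 i j
  rw [Fin.fin_one_eq_zero j, Matrix.sum_apply, Finset.sum_eq_single i]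
  · simp [colFilter]
  · intro l _ hl
    simp [colFilter, hl.symm]
  · simp

/-- The filters `U * c e_1`, `c ∈ S`, and `U * δ e_l`, `l ≥ 2`. -/
def generatorSet [NeZero r] (U : Filt d r r) (S : Set (ScalarFilter d)) : Set (Filt d r 1) :=
  {w | ∃ c ∈ S, w = U * colFilter c 0} ∪ {w | ∃ l : Fin r, l ≠ 0 ∧ w = U * colFilter 1 l}

theorem mul_mem_span_generatorSet [NeZero r] (U : Filt d r r) {S : Set (ScalarFilter d)}
    {w : Filt d r 1} (hw : w 0 0 ∈ Ideal.span S) :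
    U * w ∈ Submodule.span (ScalarFilter d) (generatorSet U S) := by
  rw [← sum_colFilter w, Matrix.mul_sum]
  refine sum_mem fun l _ => ?_
  by_cases hl : l = 0
  · subst hl
    have : ∀ c ∈ Ideal.span S,
        U * colFilter c (0 : Fin r) ∈ Submodule.span (ScalarFilter d) (generatorSet U S) := by
      intro c hc
      rw [Ideal.span] at hc
      induction hc using Submodule.span_induction with
      | mem x hx => exact Submodule.subset_span (Or.inl ⟨x, hx, rfl⟩)
      | zero =>
        have : colFilter (0 : ScalarFilter d) (0 : Fin r) = 0 := by
          ext1 i j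
          simp [colFilter]
        rw [this, Matrix.mul_zero]
        exact zero_mem _
      | add x y _ _ hx hy =>
        rw [colFilter_add, Matrix.mul_add]
        exact add_mem hx hy
      | smul z x _ hx =>
        rw [smul_eq_mul, ← smul_colFilter, Matrix.mul_smul]
        exact Submodule.smul_mem _ _ hx
    exact this _ hw
  · rw [← mul_one (w l 0), ← smul_colFilter, Matrix.mul_smul]
    exact Submodule.smul_mem _ _ (Submodule.subset_span (Or.inr ⟨l, hl, rfl⟩))

/-- After pulling back by `U`, the entries beyond the first are handled by the `colFilter 1 l`, so
only the ideal generated by the possible first entries matters. -/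
theorem generates_generatorSet [NeZero r] {U W : Filt d r r} (h : U * W = 1)
    {S : Set (ScalarFilter d)} {P Q : Set (Filt d r 1)} (hPQ : ∀ w : Filt d r 1, U * w ∈ P ↔ w ∈ Q)
    (hS : ∀ c ∈ S, colFilter c 0 ∈ Q) (hl : ∀ l : Fin r, l ≠ 0 → colFilter 1 l ∈ Q)
    (hQ : ∀ w ∈ Q, w 0 0 ∈ Ideal.span S) : Generates (generatorSet U S) P := by
  constructor
  · rintro _ (⟨c, hc, rfl⟩ | ⟨l, h0, rfl⟩)
    · exact (hPQ _).2 (hS c hc)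
    · exact (hPQ _).2 (hl l h0)
  · intro w hw
    have hw' : w = U * (W * w) := by rw [← Matrix.mul_assoc, h, Matrix.one_mul]
    rw [hw'] at hw ⊢
    exact mul_mem_span_generatorSet U (hQ _ ((hPQ _).1 hw))

theorem mem_V_rowE1_iff [NeZero r] {j : ℕ} {w : Filt d r 1} :
    w ∈ V j (rowE1 d r) ↔ w 0 0 ∈ vanishingIdeal d j := by
  rw [mem_V_iff, rowE1_mul_apply]

theorem mem_M_rowE1_iff [NeZero r] {μ : Fin d → ℕ} {w : Filt d r 1} :
    w ∈ M (rowE1 d r) μ ↔ ∀ ν, deg ν ≤ deg μ → ν ≠ μ → moment ν (w 0 0) = 0 := by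
  rw [mem_M_iff, rowE1_mul_apply]

theorem colFilter_zero_apply [NeZero r] (c : ScalarFilter d) :
    colFilter c (0 : Fin r) 0 0 = c := by
  simp [colFilter]

theorem colFilter_apply_zero [NeZero r] (c : ScalarFilter d) {l : Fin r} (hl : l ≠ 0) :
    colFilter c l 0 0 = 0 := by
  simp [colFilter, hl.symm]

theorem generates_V [NeZero r] {U W : Filt d r r} (h : U * W = 1) {j : ℕ} {y : Filt d 1 r}
    (hU : ∀ w : Filt d r 1, U * w ∈ V j y ↔ w ∈ V j (rowE1 d r)) :
    Generates (generatorSet U {c | ∃ ν : Fin d → ℕ, deg ν = j ∧ c = nablaDelta ν}) (V j y) := by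
  refine generates_generatorSet h hU ?_ (fun l hl => ?_) fun w hw => ?_
  · rintro _ ⟨ν, rfl, rfl⟩
    rw [mem_V_rowE1_iff, colFilter_zero_apply]
    exact nablaDelta_mem_vanishingIdeal ν
  · rw [mem_V_rowE1_iff, colFilter_apply_zero _ hl]
    exact zero_mem _
  · rw [mem_V_rowE1_iff, vanishingIdeal_eq_nablaIdeal] at hw
    exact hw

theorem moment_zero_right (μ : Fin d → ℕ) : moment μ (0 : ScalarFilter d) = 0 := by
  simp [moment]

theorem nablaDelta_colFilter_mem_M [NeZero r] (μ : Fin d → ℕ) :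
    colFilter (nablaDelta μ) 0 ∈ M (rowE1 d r) μ := by
  rw [mem_M_rowE1_iff, colFilter_zero_apply]
  intro ν hν hne
  rcases hν.lt_or_eq with hlt | heq
  · exact nablaDelta_mem_vanishingIdeal μ ν hlt
  · rw [moment, moment_nablaDelta heq, if_neg hne]

theorem colFilter_mem_M [NeZero r] (μ : Fin d → ℕ) {l : Fin r} (hl : l ≠ 0) :
    colFilter 1 l ∈ M (rowE1 d r) μ := by
  rw [mem_M_rowE1_iff, colFilter_apply_zero _ hl]
  intro ν _ _
  exact moment_zero_right ν

/-- The multiple of `∇^μ δ` with the same moment of order `μ` is subtracted from the first entry.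
The remainder vanishes to order `|μ| + 1` and is a combination of differences of that order. -/
theorem generates_M [NeZero r] {U W : Filt d r r} (h : U * W = 1) {μ : Fin d → ℕ}
    {y : Filt d 1 r} (hU : ∀ w : Filt d r 1, U * w ∈ M y μ ↔ w ∈ M (rowE1 d r) μ) :
    Generates (generatorSet U
      {c | ∃ ν : Fin d → ℕ, (ν = μ ∨ deg ν = deg μ + 1) ∧ c = nablaDelta ν}) (M y μ) := by
  refine generates_generatorSet h hU ?_ (fun l hl => colFilter_mem_M μ hl) fun w hw => ?_
  · rintro _ ⟨ν, rfl | hν, rfl⟩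
    · exact nablaDelta_colFilter_mem_M ν
    · rw [mem_M_rowE1_iff, colFilter_zero_apply]
      intro ν' hν' _
      exact nablaDelta_mem_vanishingIdeal ν ν' (by omega)
  · rw [mem_M_rowE1_iff] at hw
    set b : ℂ := moment μ (w 0 0) / (Complex.I ^ deg μ * ∏ i, ((μ i).factorial : ℂ)) with hb
    have h1 : w 0 0 - b • nablaDelta μ ∈ vanishingIdeal d (deg μ + 1) := by
      intro ν hν
      have hν' : deg ν ≤ deg μ := Nat.lt_succ_iff.1 hν
      have h2 := (mem_M_rowE1_iff.1 (nablaDelta_colFilter_mem_M (r := r) μ)) ν hν'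
      rw [colFilter_zero_apply] at h2
      change moment ν _ = 0 at *
      have h3 : moment ν (w 0 0 - b • nablaDelta μ) =
          moment ν (w 0 0) - b * moment ν (nablaDelta μ) := by
        simp only [moment, map_sub, map_smul, smul_eq_mul]
      rw [h3]
      by_cases hνμ : ν = μ
      · subst hνμ
        have h4 : moment ν (nablaDelta ν) = Complex.I ^ deg ν * ∏ i, ((ν i).factorial : ℂ) := by
          rw [moment, moment_nablaDelta rfl, if_pos rfl]
        rw [h4, hb, div_mul_cancel₀ _ (factor_ne_zero ν), sub_self]
      · rw [hw ν hν' hνμ, h2 hνμ, mul_zero, sub_zero]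
    rw [vanishingIdeal_eq_nablaIdeal] at h1
    have h5 : nablaIdeal d (deg μ + 1) ≤ Ideal.span
        {c | ∃ ν : Fin d → ℕ, (ν = μ ∨ deg ν = deg μ + 1) ∧ c = nablaDelta ν} := by
      refine Ideal.span_mono ?_
      rintro _ ⟨ν, hν, rfl⟩
      exact ⟨ν, Or.inr hν, rfl⟩
    rw [← sub_add_cancel (w 0 0) (b • nablaDelta μ), Algebra.smul_def]
    exact add_mem (h5 (by rwa [← Algebra.smul_def]))
      (Ideal.mul_mem_left _ _ (Ideal.subset_span ⟨μ, Or.inl rfl, rfl⟩))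

/-- In dimension one there is a single multi-index of each degree, so `∇^μ δ` alone generates the
ideal of order `|μ|`. For `μ = 0` the generator is the unit `δ`. -/
theorem generates_M_of_special [NeZero r] {U W : Filt d r r} (h : U * W = 1) {μ : Fin d → ℕ}
    (hμ : d = 1 ∨ μ = 0) {y : Filt d 1 r} (hU : ∀ w : Filt d r 1, U * w ∈ M y μ ↔ w ∈ M (rowE1 d r) μ) :
    Generates (generatorSet U {nablaDelta μ}) (M y μ) := by
  refine generates_generatorSet h hU ?_ (fun l hl => colFilter_mem_M μ hl) fun w hw => ?_
  · rintro _ rfl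
    exact nablaDelta_colFilter_mem_M μ
  · rcases hμ with rfl | rfl
    · have h1 : w 0 0 ∈ vanishingIdeal 1 (deg μ) := by
        intro ν hν
        exact mem_M_rowE1_iff.1 hw ν hν.le (by rintro rfl; exact lt_irrefl _ hν)
      rw [vanishingIdeal_eq_nablaIdeal] at h1
      refine Ideal.span_mono ?_ h1
      rintro _ ⟨ν, hν, rfl⟩
      have : ν = μ := by
        funext i
        simpa [deg, Fin.fin_one_eq_zero i] using hν
      rw [this]
      rfl
    · rw [nablaDelta_zero, Ideal.span_singleton_one]
      trivial

/-! ### Iterated subdivision -/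

theorem Conjugates.subdiv_mul {lam : ℕ} {U W a a' : Filt d r r} (h : Conjugates lam U W a a')
    (v : Filt d s r) : subdiv lam a v * U = subdiv lam a' (v * U) := by
  rw [subdiv, subdiv, Matrix.smul_mul, Matrix.mul_assoc, h.comm, upsample_mul, Matrix.mul_assoc]

theorem Conjugates.subdivIter_mul {lam : ℕ} {U W a a' : Filt d r r}
    (h : Conjugates lam U W a a') (n : ℕ) (v : Filt d s r) :
    subdivIter lam a n v * U = subdivIter lam a' n (v * U) := by
  induction n generalizing v with
  | zero => rfl
  | succ n ih =>
    rw [subdivIter, subdivIter, Function.iterate_succ_apply, Function.iterate_succ_apply,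
      ← h.subdiv_mul]
    exact ih _

/-- Subdivision commutes with left convolution up to dilating the left factor. With `v = U` and `w =
1` this separates `U` from the iterated filter. -/
theorem subdivIter_mul_right (lam : ℕ) (a : Filt d r r) (n : ℕ) (v : Filt d s t)
    (w : Filt d t r) :
    subdivIter lam a n (v * w) = upsample (lam ^ n) v * subdivIter lam a n w := by
  induction n with
  | zero => rw [pow_zero, upsample_one_left]; rfl
  | succ n ih =>
    have hs : ∀ x : Filt d t r, subdivIter lam a (n + 1) x = subdiv lam a (subdivIter lam a n x) :=
      fun x => Function.iterate_succ_apply' _ _ _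
    have hs' : ∀ x : Filt d s r, subdivIter lam a (n + 1) x = subdiv lam a (subdivIter lam a n x) :=
      fun x => Function.iterate_succ_apply' _ _ _
    rw [hs, hs', ih, subdiv, subdiv, upsample_mul, upsample_upsample, Matrix.mul_smul,
      Matrix.mul_assoc, pow_succ']

theorem subdivIter_eq_upsample_mul (lam : ℕ) (a : Filt d r r) (n : ℕ) (v : Filt d s r) :
    subdivIter lam a n v = upsample (lam ^ n) v * subdivIter lam a n (1 : Filt d r r) := by
  rw [← subdivIter_mul_right, Matrix.mul_one]

theorem Conjugates.subdivIter_one_mul {lam : ℕ} {U W a a' : Filt d r r}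
    (h : Conjugates lam U W a a') (n : ℕ) (w : Filt d r 1) :
    subdivIter lam a n (1 : Filt d r r) * (U * w) = subdivIter lam a' n U * w := by
  rw [← Matrix.mul_assoc, h.subdivIter_mul, Matrix.one_mul]

theorem Conjugates.fourierSeries_iterFilter_mul {lam : ℕ} {U W a a' : Filt d r r}
    (h : Conjugates lam U W a a') (n : ℕ) (w : Filt d r 1) (ξ : Rd d) :
    fourierSeries (iterFilter lam a n) ξ * fourierSeries (U * w) ξ =
      fourierSeries U ((lam : ℝ) ^ n • ξ) * fourierSeries (iterFilter lam a' n) ξ *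
        fourierSeries w ξ := by
  rw [← Nat.cast_pow, ← fourierSeries_upsample, ← fourierSeries_mul, ← fourierSeries_mul,
    ← fourierSeries_mul]
  congr 1
  rw [iterFilter, iterFilter, Matrix.smul_mul, Matrix.mul_smul, Matrix.smul_mul,
    h.subdivIter_one_mul, ← subdivIter_eq_upsample_mul]

theorem val_subdivIter_mul (lam : ℕ) (a : Filt d r r) (n : ℕ) (U : Filt d r r) (w : Filt d r 1)
    (k : Fin d → ℤ) :
    val (subdivIter lam a n U * w) k =
      ∑ᶠ z : Fin d → ℤ, val U z *
        val (subdivIter lam a n (1 : Filt d r r) * w) (k - lam ^ n • z) := by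
  rw [subdivIter_eq_upsample_mul, Matrix.mul_assoc]
  exact val_map_mul (fun z => lam ^ n • z) U _ k

/-! ### Norm bounds and growth rates -/

theorem seqNorm_add_le {p : ℝ≥0∞} (hp : 1 ≤ p) (f g : (Fin d → ℤ) → ℂ) :
    seqNorm p (f + g) ≤ seqNorm p f + seqNorm p g :=
  MeasureTheory.eLpNorm_add_le (measurable_of_countable f).aestronglyMeasurable
    (measurable_of_countable g).aestronglyMeasurable hp

theorem seqNorm_zero (p : ℝ≥0∞) : seqNorm p (0 : (Fin d → ℤ) → ℂ) = 0 :=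
  MeasureTheory.eLpNorm_zero

theorem seqNorm_sum_le {ι : Type*} {p : ℝ≥0∞} (hp : 1 ≤ p) (S : Finset ι)
    (f : ι → (Fin d → ℤ) → ℂ) : seqNorm p (∑ i ∈ S, f i) ≤ ∑ i ∈ S, seqNorm p (f i) :=
  MeasureTheory.eLpNorm_sum_le (fun i _ => (measurable_of_countable (f i)).aestronglyMeasurable) hp

theorem seqNorm_translate (p : ℝ≥0∞) (f : (Fin d → ℤ) → ℂ) (z : Fin d → ℤ) :
    seqNorm p (fun k => f (-z + k)) = seqNorm p f := by
  exact MeasureTheory.eLpNorm_comp_measurePreserving (g := f)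
    (measurable_of_countable f).aestronglyMeasurable
    (MeasureTheory.measurePreserving_add_left MeasureTheory.Measure.count (-z))

/-- Convolution with a filter is a combination of translations, which are isometries of `ℓ_p`.
Upsampling moves the translations and keeps the coefficients, so the constant does not depend on
`N`. -/
theorem exists_seqNorm_upsampleHom_mul_le {p : ℝ≥0∞} (hp : 1 ≤ p) (x : ScalarFilter d) :
    ∃ C : ℝ≥0∞, C ≠ ∞ ∧ ∀ (N : ℕ) (y : ScalarFilter d),
      seqNorm p (upsampleHom d N x * y).coeff ≤ C * seqNorm p y.coeff := by
  induction x using AddMonoidAlgebra.induction_linear with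
  | zero =>
    refine ⟨0, ENNReal.zero_ne_top, fun N y => ?_⟩
    rw [map_zero, zero_mul, zero_mul]
    exact (seqNorm_zero p).le
  | add x x' hx hx' =>
    obtain ⟨C, hC, h⟩ := hx
    obtain ⟨C', hC', h'⟩ := hx'
    refine ⟨C + C', ENNReal.add_ne_top.2 ⟨hC, hC'⟩, fun N y => ?_⟩
    rw [map_add, add_mul, add_mul]
    exact (seqNorm_add_le hp _ _).trans (add_le_add (h N y) (h' N y))
  | single k b =>
    refine ⟨‖b‖ₑ, enorm_ne_top, fun N y => ?_⟩
    have h1 : ⇑(upsampleHom d N (AddMonoidAlgebra.single k b) * y).coeff =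
        b • fun k' => y.coeff (-(N • k) + k') := by
      funext k'
      rw [upsampleHom_single, AddMonoidAlgebra.coeff_single_mul_apply]
      rfl
    rw [h1, seqNorm, MeasureTheory.eLpNorm_const_smul]
    exact (congrArg _ (seqNorm_translate p y.coeff (N • k))).le

theorem exists_colNorm_upsample_mul_le {p : ℝ≥0∞} (hp : 1 ≤ p) (U : Filt d r r) :
    ∃ C : ℝ≥0∞, C ≠ ∞ ∧ ∀ (N : ℕ) (w : Filt d r 1),
      colNorm p (upsample N U * w) ≤ C * colNorm p w := by
  choose C hC h using fun i j => exists_seqNorm_upsampleHom_mul_le hp (U i j)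
  refine ⟨∑ i, ∑ j, C i j, ?_, fun N w => ?_⟩
  · simp only [ENNReal.sum_ne_top]
    exact fun i _ j _ => hC i j
  · rw [colNorm, Finset.sum_mul]
    refine Finset.sum_le_sum fun i _ => ?_
    have h1 : (fun k => ((upsample N U * w) i 0).coeff k) =
        ∑ j, ⇑(upsampleHom d N (U i j) * w j 0).coeff := by
      funext k
      rw [Matrix.mul_apply, AddMonoidAlgebra.coeff_sum, Finsupp.finsetSum_apply, Finset.sum_apply]
      rfl
    rw [h1, Finset.sum_mul]
    refine (seqNorm_sum_le hp _ _).trans (Finset.sum_le_sum fun j _ => (h i j N _).trans ?_)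
    gcongr
    exact Finset.single_le_sum (f := fun j => seqNorm p fun k => (w j 0).coeff k)
      (fun _ _ => zero_le) (Finset.mem_univ j)

theorem tendsto_const_rpow_one_div {C : ℝ≥0∞} (h0 : C ≠ 0) (hC : C ≠ ∞) :
    Filter.Tendsto (fun n : ℕ => C ^ (1 / (n : ℝ))) Filter.atTop (nhds 1) := by
  lift C to NNReal using hC
  have h0' : C ≠ 0 := by simpa using h0
  have h1 : Filter.Tendsto (fun n : ℕ => C ^ (1 / (n : ℝ))) Filter.atTop (nhds (C ^ (0 : ℝ))) :=
    tendsto_const_nhds.nnrpow tendsto_one_div_atTop_nhds_zero_nat (Or.inl h0')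
  rw [NNReal.rpow_zero] at h1
  simp only [← ENNReal.coe_rpow_of_ne_zero h0']
  rw [← ENNReal.coe_one]
  exact ENNReal.tendsto_coe.2 h1

/-- The two sequences of norms differ by at most a factor independent of `n`, which the `n`-th root
removes in the limit. -/
theorem Conjugates.growthRate_le {lam : ℕ} {U W a a' : Filt d r r}
    (h : Conjugates lam U W a a') {p : ℝ≥0∞} (hp : 1 ≤ p) (w : Filt d r 1) :
    growthRate lam a p (U * w) ≤ growthRate lam a' p w := by
  obtain ⟨C, hC, hle⟩ := exists_colNorm_upsample_mul_le hp U
  -- `C` may be 0, and then its roots would not tend to 1; `C + 1` is a nonzero bound.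
  have hC1 : C + 1 ≠ ∞ := ENNReal.add_ne_top.2 ⟨hC, ENNReal.one_ne_top⟩
  have hlim := (tendsto_const_rpow_one_div (C := C + 1) (by simp) hC1).limsup_eq
  have hbound : ∀ n : ℕ,
      colNorm p (subdivIter lam a n (1 : Filt d r r) * (U * w)) ^ (1 / (n : ℝ)) ≤
        (C + 1) ^ (1 / (n : ℝ)) *
          colNorm p (subdivIter lam a' n (1 : Filt d r r) * w) ^ (1 / (n : ℝ)) := by
    intro n
    have hn : (0 : ℝ) ≤ 1 / n := by positivity
    rw [← ENNReal.mul_rpow_of_nonneg _ _ hn]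
    refine ENNReal.rpow_le_rpow ?_ hn
    rw [h.subdivIter_one_mul, subdivIter_eq_upsample_mul, Matrix.mul_assoc]
    exact (hle _ _).trans (by gcongr; exact le_self_add)
  calc growthRate lam a p (U * w)
      ≤ Filter.limsup ((fun n : ℕ => (C + 1) ^ (1 / (n : ℝ))) * fun n : ℕ =>
          colNorm p (subdivIter lam a' n (1 : Filt d r r) * w) ^ (1 / (n : ℝ))) Filter.atTop :=
        Filter.limsup_le_limsup (Filter.Eventually.of_forall hbound)
    _ ≤ Filter.limsup (fun n : ℕ => (C + 1) ^ (1 / (n : ℝ))) Filter.atTop *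
          growthRate lam a' p w :=
        ENNReal.limsup_mul_le' (Or.inl (by rw [hlim]; exact one_ne_zero))
          (Or.inl (by rw [hlim]; exact ENNReal.one_ne_top))
    _ = growthRate lam a' p w := by rw [hlim, one_mul]

theorem Conjugates.rhoAt_le {lam : ℕ} {U W a a' : Filt d r r}
    (h : Conjugates lam U W a a') {p : ℝ≥0∞} (hp : 1 ≤ p) (y : Filt d 1 r) (j : ℕ) :
    rhoAt lam a y p j ≤ rhoAt lam a' (y * U) p j := by
  refine iSup₂_le fun w hw => ?_
  have hw' : w = U * (W * w) := by rw [← Matrix.mul_assoc, h.mul_inv, Matrix.one_mul]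
  rw [hw'] at hw ⊢
  exact (h.growthRate_le hp _).trans
    (le_iSup₂ (f := fun w (_ : w ∈ V j (y * U)) => growthRate lam a' p w) _ (mul_mem_V_iff.1 hw))

theorem Conjugates.rhoAt_eq {lam : ℕ} {U W a a' : Filt d r r}
    (h : Conjugates lam U W a a') {p : ℝ≥0∞} (hp : 1 ≤ p) (y : Filt d 1 r) (j : ℕ) :
    rhoAt lam a y p j = rhoAt lam a' (y * U) p j := by
  refine le_antisymm (h.rhoAt_le hp y j) ?_
  have := h.symm.rhoAt_le hp (y * U) j
  rwa [h.mul_mul_cancel] at this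

theorem Conjugates.sumRuleOrder_le {lam : ℕ} {U W a a' : Filt d r r}
    (h : Conjugates lam U W a a') (hlam : lam ≠ 0) :
    sumRuleOrder lam a ≤ sumRuleOrder lam a' := by
  refine iSup₂_le fun n hn => ?_
  obtain ⟨y, hy⟩ := hn
  exact le_iSup₂ (f := fun (n : ℕ) (_ : ∃ y : Filt d 1 r, SumRules lam n a' y) => (n : ℕ∞)) n
    ⟨y * U, h.sumRules hlam hy⟩

/-- `y ↦ y * U` sends admissible pairs `(j, y)` for `a` to admissible pairs for `a'` with the same
value of `rhoAt`. All orders of sum rules are covered, with no truncation at `m + 1`. -/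
theorem Conjugates.rho_le {lam : ℕ} {U W a a' : Filt d r r}
    (h : Conjugates lam U W a a') (hlam : lam ≠ 0) {p : ℝ≥0∞} (hp : 1 ≤ p) :
    rho lam a' p ≤ rho lam a p := by
  refine le_iInf fun j => le_iInf fun y => le_iInf fun hjy => ?_
  rw [h.rhoAt_eq hp]
  exact iInf_le_of_le j (iInf_le_of_le (y * U) (iInf_le_of_le
    ⟨hjy.1.trans (h.sumRuleOrder_le hlam), h.sumRules hlam hjy.2⟩ le_rfl))

theorem Conjugates.rho_eq {lam : ℕ} {U W a a' : Filt d r r}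
    (h : Conjugates lam U W a a') (hlam : lam ≠ 0) {p : ℝ≥0∞} (hp : 1 ≤ p) :
    rho lam a p = rho lam a' p :=
  le_antisymm (h.symm.rho_le hlam hp) (h.rho_le hlam hp)

theorem Conjugates.sm_eq {lam : ℕ} {U W a a' : Filt d r r}
    (h : Conjugates lam U W a a') (hlam : lam ≠ 0) {p : ℝ≥0∞} (hp : 1 ≤ p) :
    sm lam a p = sm lam a' p := by
  rw [sm, sm, h.rho_eq hlam hp]

/-! ### Convergence -/

theorem Conjugates.cmConvergentWith {lam m : ℕ} {U W a a' : Filt d r r}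
    (h : Conjugates lam U W a a') (hlam : lam ≠ 0) {y : Filt d 1 r}
    (hy : CmConvergentWith lam m a y) : CmConvergentWith lam m a' (y * U) := by
  refine ⟨h.sumRules hlam hy.1, fun v => ?_⟩
  -- Starting from `v * W` and testing with `U * u`, the factors cancel and the sequence for `a'`,
  -- `v`, `u` appears, so the same `η` works.
  obtain ⟨η, hη, hlim⟩ := hy.2 (v * W)
  refine ⟨η, hη, fun μ hμ u hu => ?_⟩
  have h1 := hlim μ hμ (U * u) (mul_mem_M_iff.2 hu)
  have h2 : ∀ n, subdivIter lam a n (v * W) * (U * u) = subdivIter lam a' n v * u := by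
    intro n
    rw [← Matrix.mul_assoc, h.subdivIter_mul, h.symm.mul_mul_cancel]
  simpa only [h2, beta_mul] using h1

theorem Conjugates.cmConvergentWith_iff {lam m : ℕ} {U W a a' : Filt d r r}
    (h : Conjugates lam U W a a') (hlam : lam ≠ 0) {y : Filt d 1 r} :
    CmConvergentWith lam m a y ↔ CmConvergentWith lam m a' (y * U) := by
  refine ⟨h.cmConvergentWith hlam, fun hy => ?_⟩
  have := h.symm.cmConvergentWith hlam hy
  rwa [h.mul_mul_cancel] at this

theorem Conjugates.cmConvergent_iff {lam m : ℕ} {U W a a' : Filt d r r}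
    (h : Conjugates lam U W a a') (hlam : lam ≠ 0) :
    CmConvergent lam m a ↔ CmConvergent lam m a' :=
  ⟨fun ⟨y, hy⟩ => ⟨y * U, h.cmConvergentWith hlam hy⟩,
    fun ⟨y, hy⟩ => ⟨y * W, h.symm.cmConvergentWith hlam hy⟩⟩

theorem CmConvergentWith.congr {lam m : ℕ} {a : Filt d r r} {y y' : Filt d 1 r}
    (hy : CmConvergentWith lam m a y) (h : RowEqO (m + 1) y y') :
    CmConvergentWith lam m a y' := by
  refine ⟨hy.1.congr (Nat.succ_pos m) h, fun v => ?_⟩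
  obtain ⟨η, hη, hlim⟩ := hy.2 v
  refine ⟨η, hη, fun μ hμ u hu => ?_⟩
  rw [← h.M_eq (Nat.lt_succ_iff.2 hμ)] at hu
  rw [← h.beta_eq (Nat.lt_succ_iff.2 hμ)]
  exact hlim μ hμ u hu

/-! ### Translation of tempered distributions -/

theorem hasTemperateGrowth_cexp_I_mul :
    Function.HasTemperateGrowth fun x : ℝ => Complex.exp (Complex.I * (x : ℂ)) := by
  have hd : ∀ (c : ℂ) (x : ℝ), HasDerivAt (fun x : ℝ => c * Complex.exp (Complex.I * (x : ℂ)))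
      (c * Complex.I * Complex.exp (Complex.I * (x : ℂ))) x := by
    intro c x
    have h1 : HasDerivAt (fun x : ℝ => Complex.I * (x : ℂ)) (Complex.I * 1) x :=
      (Complex.ofRealCLM.hasDerivAt (x := x)).const_mul _
    refine (h1.cexp.const_mul c).congr_deriv ?_
    ring
  have hi : ∀ n : ℕ, iteratedDeriv n (fun x : ℝ => Complex.exp (Complex.I * (x : ℂ))) =
      fun x : ℝ => Complex.I ^ n * Complex.exp (Complex.I * (x : ℂ)) := by
    intro n
    induction n with
    | zero => simp
    | succ n ih =>
      rw [iteratedDeriv_succ, ih]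
      funext x
      rw [(hd (Complex.I ^ n) x).deriv, pow_succ]
  -- All derivatives have modulus 1: growth exponent 0, constant 1.
  refine ⟨?_, fun n => ⟨0, 1, fun x => ?_⟩⟩
  · exact (contDiff_const.mul Complex.ofRealCLM.contDiff).cexp
  · rw [norm_iteratedFDeriv_eq_norm_iteratedDeriv, hi, norm_mul, norm_pow, Complex.norm_I,
      one_pow, mul_comm Complex.I, Complex.norm_exp_ofReal_mul_I]
    simp

/-- The character `ξ ↦ e^{-2πi a·ξ}`. -/
noncomputable def expInner (a ξ : Rd d) : ℂ :=
  Complex.exp (Complex.I * ((-(2 * Real.pi) * inner ℝ a ξ : ℝ) : ℂ))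

theorem hasTemperateGrowth_expInner (a : Rd d) : Function.HasTemperateGrowth (expInner a) := by
  have h1 : Function.HasTemperateGrowth fun ξ : Rd d => -(2 * Real.pi) * inner ℝ a ξ :=
    (Function.HasTemperateGrowth.const _).mul (Function.hasTemperateGrowth_inner_right a)
  exact hasTemperateGrowth_cexp_I_mul.comp h1

/-- The translate `T(· - a)` of a tempered distribution. -/
noncomputable def translate (a : Rd d) (T : 𝓢'(Rd d, ℂ)) : 𝓢'(Rd d, ℂ) :=
  PointwiseConvergenceCLM.precomp ℂ (SchwartzMap.compSubConstCLM ℂ (-a)) T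

theorem translate_apply (a : Rd d) (T : 𝓢'(Rd d, ℂ)) (f : 𝓢(Rd d, ℂ)) :
    translate a T f = T (f.compSubConstCLM ℂ (-a)) := rfl

/-- Translation of a transform is modulation of the function. By duality this gives the transform of
a translated distribution. -/
theorem compSubConstCLM_fourier (a : Rd d) (f : 𝓢(Rd d, ℂ)) :
    (FourierTransform.fourier f).compSubConstCLM ℂ (-a) =
      FourierTransform.fourier (SchwartzMap.smulLeftCLM ℂ (expInner a) f) := by
  ext x
  rw [SchwartzMap.compSubConstCLM_apply, SchwartzMap.fourier_coe, SchwartzMap.fourier_coe,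
    Real.fourier_eq', Real.fourier_eq']
  refine MeasureTheory.integral_congr_ae (Filter.Eventually.of_forall fun ξ => ?_)
  change _ • _ = _ • _
  rw [SchwartzMap.smulLeftCLM_apply_apply (hasTemperateGrowth_expInner a), smul_smul, expInner,
    ← Complex.exp_add]
  congr 2
  rw [sub_neg_eq_add, inner_add_right, real_inner_comm ξ a]
  push_cast
  ring

theorem hasFourier_iff {T : 𝓢'(Rd d, ℂ)} {F : Rd d → ℂ} :
    HasFourier T F ↔ (Function.HasTemperateGrowth fun ξ : Rd d => F ((2 * Real.pi) • ξ)) ∧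
      ∀ f : 𝓢(Rd d, ℂ), T (FourierTransform.fourier f) = ∫ ξ, f ξ • F ((2 * Real.pi) • ξ) := by
  constructor
  · rintro ⟨h, hT⟩
    exact ⟨h, fun f => DFunLike.congr_fun hT f⟩
  · rintro ⟨h, hT⟩
    refine ⟨h, ?_⟩
    ext f
    exact hT f

theorem integrable_smul_of_hasTemperateGrowth {G : Rd d → ℂ}
    (hG : Function.HasTemperateGrowth G) (f : 𝓢(Rd d, ℂ)) :
    MeasureTheory.Integrable fun ξ => f ξ • G ξ := by
  refine (SchwartzMap.smulLeftCLM ℂ G f).integrable.congr (Filter.Eventually.of_forall fun ξ => ?_)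
  rw [SchwartzMap.smulLeftCLM_apply_apply hG]
  exact mul_comm _ _

theorem hasFourier_zero : HasFourier (0 : 𝓢'(Rd d, ℂ)) fun _ => 0 := by
  rw [hasFourier_iff]
  refine ⟨Function.HasTemperateGrowth.const 0, fun f => ?_⟩
  simp

theorem HasFourier.add {T T' : 𝓢'(Rd d, ℂ)} {F F' : Rd d → ℂ} (h : HasFourier T F)
    (h' : HasFourier T' F') : HasFourier (T + T') fun ξ => F ξ + F' ξ := by
  rw [hasFourier_iff] at h h' ⊢
  refine ⟨h.1.add h'.1, fun f => ?_⟩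
  simp only [smul_add]
  rw [MeasureTheory.integral_add (integrable_smul_of_hasTemperateGrowth h.1 f)
    (integrable_smul_of_hasTemperateGrowth h'.1 f), ← h.2, ← h'.2]
  rfl

theorem HasFourier.const_smul {T : 𝓢'(Rd d, ℂ)} {F : Rd d → ℂ} (h : HasFourier T F) (c : ℂ) :
    HasFourier (c • T) fun ξ => c * F ξ := by
  rw [hasFourier_iff] at h ⊢
  refine ⟨(Function.HasTemperateGrowth.const c).mul h.1, fun f => ?_⟩
  change c • T (FourierTransform.fourier f) = _
  rw [h.2, ← MeasureTheory.integral_smul]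
  refine MeasureTheory.integral_congr_ae (Filter.Eventually.of_forall fun ξ => ?_)
  simp only [smul_eq_mul]
  ring

theorem HasFourier.sum {ι : Type*} (S : Finset ι) {T : ι → 𝓢'(Rd d, ℂ)} {F : ι → Rd d → ℂ}
    (h : ∀ i, HasFourier (T i) (F i)) : HasFourier (∑ i ∈ S, T i) fun ξ => ∑ i ∈ S, F i ξ := by
  classical
  induction S using Finset.induction_on with
  | empty => simpa using hasFourier_zero
  | insert i S hi ih => simpa only [Finset.sum_insert hi] using (h i).add ih

theorem HasFourier.translate {T : 𝓢'(Rd d, ℂ)} {F : Rd d → ℂ} (h : HasFourier T F)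
    (k : Fin d → ℤ) :
    HasFourier (translate (WithLp.toLp 2 fun i => (k i : ℝ)) T)
      fun ξ => evalHom ξ (AddMonoidAlgebra.single k 1) * F ξ := by
  rw [hasFourier_iff] at h ⊢
  -- The rescaling by `2π` in `HasFourier` matches `e^{-i k·ξ}` with the kernel `e^{-2πi k·ξ}`.
  have he : ∀ ξ : Rd d, evalHom ((2 * Real.pi) • ξ) (AddMonoidAlgebra.single k 1) =
      expInner (WithLp.toLp 2 fun i => (k i : ℝ)) ξ := by
    intro ξ
    rw [evalHom_single, one_mul, expInner, PiLp.inner_apply]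
    congr 1
    simp only [PiLp.smul_apply, smul_eq_mul, RCLike.inner_apply, conj_trivial]
    push_cast
    rw [Finset.mul_sum, Finset.mul_sum, Finset.mul_sum, ← Finset.sum_neg_distrib]
    refine Finset.sum_congr rfl fun l _ => ?_
    ring
  simp only [he]
  refine ⟨(hasTemperateGrowth_expInner _).mul h.1, fun f => ?_⟩
  rw [translate_apply, compSubConstCLM_fourier, h.2]
  refine MeasureTheory.integral_congr_ae (Filter.Eventually.of_forall fun ξ => ?_)
  change _ • _ = _ • _
  rw [SchwartzMap.smulLeftCLM_apply_apply (hasTemperateGrowth_expInner _)]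
  simp only [smul_eq_mul]
  ring

/-! ### Supports -/

theorem dsupport_zero : Distribution.dsupport ((0 : 𝓢'(Rd d, ℂ)) : 𝓢(Rd d, ℂ) → ℂ) = ∅ := by
  refine Set.eq_empty_of_forall_notMem fun x => ?_
  rw [Distribution.notMem_dsupport_iff]
  exact ⟨Set.univ, fun u _ => rfl, isOpen_univ, Set.mem_univ x⟩

theorem dsupport_add_subset (T T' : 𝓢'(Rd d, ℂ)) :
    Distribution.dsupport (T + T' : 𝓢'(Rd d, ℂ)) ⊆ Distribution.dsupport T ∪ Distribution.dsupport T' := by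
  intro x hx
  by_contra hx'
  rw [Set.mem_union, not_or, Distribution.notMem_dsupport_iff, Distribution.notMem_dsupport_iff]
    at hx'
  obtain ⟨⟨s, hs, hso, hxs⟩, ⟨s', hs', hso', hxs'⟩⟩ := hx'
  refine (Distribution.notMem_dsupport_iff x).2 ⟨s ∩ s', fun u hu => ?_, hso.inter hso', hxs, hxs'⟩ hx
  change T u + T' u = 0
  rw [hs u (hu.trans Set.inter_subset_left), hs' u (hu.trans Set.inter_subset_right), add_zero]

theorem dsupport_const_smul_subset (c : ℂ) (T : 𝓢'(Rd d, ℂ)) :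
    Distribution.dsupport (c • T : 𝓢'(Rd d, ℂ)) ⊆ Distribution.dsupport T := by
  refine fun x hx => by_contra fun hx' => ?_
  rw [Distribution.notMem_dsupport_iff] at hx'
  obtain ⟨s, hs, hso, hxs⟩ := hx'
  refine (Distribution.notMem_dsupport_iff x).2 ⟨s, fun u hu => ?_, hso, hxs⟩ hx
  change c • T u = 0
  rw [hs u hu, smul_zero]

theorem dsupport_translate_subset (a : Rd d) (T : 𝓢'(Rd d, ℂ)) :
    Distribution.dsupport (translate a T) ⊆ (fun x => x + a) '' Distribution.dsupport T := by
  refine fun x hx => ⟨x - a, by_contra fun hx' => ?_, sub_add_cancel x a⟩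
  rw [Distribution.notMem_dsupport_iff] at hx'
  obtain ⟨s, hs, hso, hxs⟩ := hx'
  refine (Distribution.notMem_dsupport_iff x).2
    ⟨(fun x => x - a) ⁻¹' s, fun u hu => ?_, hso.preimage (by fun_prop), hxs⟩ hx
  rw [translate_apply]
  apply hs
  have h1 : tsupport (u.compSubConstCLM ℂ (-a)) ⊆ (fun x => x - -a) ⁻¹' tsupport u :=
    tsupport_comp_subset_preimage (f := fun x : Rd d => x - -a) u (by fun_prop)
  intro z hz
  have := hu (h1 hz)
  simpa using this

theorem isCompact_dsupport_add {T T' : 𝓢'(Rd d, ℂ)} (h : IsCompact (Distribution.dsupport T))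
    (h' : IsCompact (Distribution.dsupport T')) : IsCompact (Distribution.dsupport (T + T' : 𝓢'(Rd d, ℂ))) :=
  (h.union h').of_isClosed_subset Distribution.isClosed_dsupport (dsupport_add_subset T T')

theorem isCompact_dsupport_sum {ι : Type*} (S : Finset ι) {T : ι → 𝓢'(Rd d, ℂ)}
    (h : ∀ i, IsCompact (Distribution.dsupport (T i))) :
    IsCompact (Distribution.dsupport (∑ i ∈ S, T i : 𝓢'(Rd d, ℂ))) := by
  classical
  induction S using Finset.induction_on with
  | empty =>
    rw [Finset.sum_empty, dsupport_zero]
    exact isCompact_empty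
  | insert i S hi ih =>
    rw [Finset.sum_insert hi]
    exact isCompact_dsupport_add (h i) ih

/-! ### Convolution of filters and distributions -/

/-- The distribution `∑_k c(k) T(· - k)` works. It is chosen before `F`, so one `T'` serves every
function representing the transform of `T`. -/
theorem exists_filter_conv (c : ScalarFilter d) {T : 𝓢'(Rd d, ℂ)}
    (hT : IsCompact (Distribution.dsupport T)) :
    ∃ T' : 𝓢'(Rd d, ℂ), IsCompact (Distribution.dsupport T') ∧
      ∀ F, HasFourier T F → HasFourier T' fun ξ => evalHom ξ c * F ξ := by
  induction c using AddMonoidAlgebra.induction_linear with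
  | zero =>
    refine ⟨0, dsupport_zero ▸ isCompact_empty, fun F _ => ?_⟩
    simpa using hasFourier_zero
  | add x y hx hy =>
    obtain ⟨T₁, h₁, h₁'⟩ := hx
    obtain ⟨T₂, h₂, h₂'⟩ := hy
    refine ⟨T₁ + T₂, isCompact_dsupport_add h₁ h₂, fun F hF => ?_⟩
    simpa only [map_add, add_mul] using (h₁' F hF).add (h₂' F hF)
  | single k b =>
    set a : Rd d := WithLp.toLp 2 fun i => (k i : ℝ) with ha
    refine ⟨b • translate a T, ?_, fun F hF => ?_⟩
    · exact (hT.image (f := fun x => x + a) (by fun_prop)).of_isClosed_subset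
        Distribution.isClosed_dsupport
        ((dsupport_const_smul_subset _ _).trans (dsupport_translate_subset _ _))
    · have := (hF.translate k).const_smul b
      simpa only [evalHom_single, one_mul, mul_assoc] using this

theorem exists_filter_conv_vec (W : Filt d r r) {φ : Fin r → 𝓢'(Rd d, ℂ)}
    (hφ : ∀ l, IsCompact (Distribution.dsupport (φ l))) :
    ∃ φ' : Fin r → 𝓢'(Rd d, ℂ), (∀ l, IsCompact (Distribution.dsupport (φ' l))) ∧
      ∀ Φ, HasFourierVec φ Φ → HasFourierVec φ' fun ξ => (fourierSeries W ξ).mulVec (Φ ξ) := by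
  choose T hT hT' using fun i j => exists_filter_conv (W i j) (hφ j)
  refine ⟨fun i => ∑ j, T i j, fun i => isCompact_dsupport_sum _ (hT i), fun Φ hΦ i => ?_⟩
  have := HasFourier.sum Finset.univ fun j => hT' i j _ (hΦ j)
  simpa only [Matrix.mulVec, dotProduct, fourierSeries_apply] using this

/-- The vector is convolved with `W`. Refinability is the reversed relation `a' * W = upsample lam W
* a`, and the normalization follows from `y * U * W = y`. -/
theorem Conjugates.exists_refinable {lam : ℕ} {U W a a' : Filt d r r}
    (h : Conjugates lam U W a a') {y y' : Filt d 1 r}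
    (hy : fourierSeries (y * U) 0 = fourierSeries y' 0) {φ : Fin r → 𝓢'(Rd d, ℂ)}
    (hφ : IsStandardRefinable lam a y φ) :
    ∃ φ' : Fin r → 𝓢'(Rd d, ℂ),
      (∀ Φ, HasFourierVec φ Φ →
        HasFourierVec φ' fun ξ => ((fourierSeries U ξ)⁻¹).mulVec (Φ ξ)) ∧
      IsStandardRefinable lam a' y' φ' := by
  obtain ⟨hc, Φ, hΦ, href, hnorm⟩ := hφ
  obtain ⟨φ', hc', hφ'⟩ := exists_filter_conv_vec W hc
  simp only [fourierSeries_inv h.mul_inv]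
  refine ⟨φ', hφ', hc', _, hφ' Φ hΦ, fun ξ => ?_, ?_⟩
  · rw [href, Matrix.mulVec_mulVec, Matrix.mulVec_mulVec, ← fourierSeries_upsample,
      ← fourierSeries_mul, ← fourierSeries_mul, h.symm.comm]
  · rw [← hy, Matrix.mulVec_mulVec, ← fourierSeries_mul, h.mul_mul_cancel, hnorm]

end VecSubdivision

theorem mainTheorem6 (d r lam m : ℕ) (hd : 0 < d) [NeZero r] (hlam : 2 ≤ lam)
    (a : Filt d r r) (y : Filt d 1 r) (hy : SumRules lam (m + 1) a y)
    (U : Filt d r r) (hU : StronglyInvertible U)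
    (hyU : EqO (m + 1) (fun ξ => fourierSeries y ξ * fourierSeries U ξ)
      (fun _ => Matrix.of fun _ j => if j = 0 then 1 else 0)) :
    ∃ a' : Filt d r r,
      -- the transformed filter
      (∀ ξ : Rd d, fourierSeries a' ξ =
        (fourierSeries U ((lam : ℝ) • ξ))⁻¹ * fourierSeries a ξ * fourierSeries U ξ) ∧
      -- (1) the transformed refinable vector
      (∀ φ, IsStandardRefinable lam a y φ →
        ∃ φ', (∀ Φ, HasFourierVec φ Φ →
            HasFourierVec φ' fun ξ => ((fourierSeries U ξ)⁻¹).mulVec (Φ ξ)) ∧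
          IsStandardRefinable lam a' (rowE1 d r) φ') ∧
      -- (2) the transformed filter is of scalar type
      IsScalarType lam (m + 1) a' ∧
      -- (3) bijections between the spaces, and generating sets
      (∀ j ≤ m + 1,
        Set.BijOn (fun w : Filt d r 1 => U * w) (V j (rowE1 d r)) (V j y) ∧
        Generates
          ({w | ∃ ν : Fin d → ℕ, deg ν = j ∧ w = U * colFilter (nablaDelta ν) 0} ∪
            {w | ∃ l : Fin r, l ≠ 0 ∧ w = U * colFilter 1 l}) (V j y)) ∧
      (∀ μ : Fin d → ℕ, deg μ ≤ m →
        Set.BijOn (fun u : Filt d r 1 => U * u) (M (rowE1 d r) μ) (M y μ) ∧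
        Generates
          ({u | ∃ ν : Fin d → ℕ, (ν = μ ∨ deg ν = deg μ + 1) ∧
              u = U * colFilter (nablaDelta ν) 0} ∪
            {u | ∃ l : Fin r, l ≠ 0 ∧ u = U * colFilter 1 l}) (M y μ) ∧
        (d = 1 ∨ μ = 0 →
          Generates
            ({U * colFilter (nablaDelta μ) 0} ∪
              {u | ∃ l : Fin r, l ≠ 0 ∧ u = U * colFilter 1 l}) (M y μ))) ∧
      -- (4) comparison of the iterated filters and of the smoothness exponents
      (∀ j ≤ m + 1, ∀ w' ∈ V j (rowE1 d r), ∀ n : ℕ,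
        (∀ ξ : Rd d, fourierSeries (iterFilter lam a n) ξ * fourierSeries (U * w') ξ =
          fourierSeries U ((lam : ℝ) ^ n • ξ) * fourierSeries (iterFilter lam a' n) ξ *
            fourierSeries w' ξ) ∧
        subdivIter lam a n (1 : Filt d r r) * (U * w') = subdivIter lam a' n U * w' ∧
        ∀ k : Fin d → ℤ, val (subdivIter lam a' n U * w') k =
          ∑ᶠ z : Fin d → ℤ, val U z * val (subdivIter lam a' n (1 : Filt d r r) * w') (k - lam ^ n • z)) ∧
      (∀ p : ℝ≥0∞, 1 ≤ p →
        (∀ j ≤ m + 1,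
          (∀ w' ∈ V j (rowE1 d r), growthRate lam a p (U * w') ≤ growthRate lam a' p w') ∧
          rhoAt lam a y p j = rhoAt lam a' (rowE1 d r) p j) ∧
        rho lam a p = rho lam a' p ∧
        sm lam a p = sm lam a' p) ∧
      -- equivalence of the convergence of the two schemes
      (CmConvergentWith lam m a y ↔ CmConvergentWith lam m a' (rowE1 d r)) ∧
      (CmConvergent lam m a ↔ CmConvergent lam m a') := by
  have hlam0 : lam ≠ 0 := by omega
  obtain ⟨W, hUW, hWU⟩ := hU.exists_inverse
  have hc : Conjugates lam U W a (upsample lam W * a * U) := Conjugates.of_inverse hUW hWU a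
  set a' := upsample lam W * a * U with ha'
  -- The normalization of `U` as a congruence of filters; it lets `rowE1` replace `y * U` up to
  -- order `m + 1`.
  have hrow : RowEqO (m + 1) (y * U) (rowE1 d r) := by
    intro i j
    refine (eqO_fourierSeries (A := y * U) (B := rowE1 d r)).1 ?_ i j
    have h1 : fourierSeries (y * U) = fun ξ => fourierSeries y ξ * fourierSeries U ξ :=
      funext (fourierSeries_mul y U)
    have h2 : fourierSeries (rowE1 d r) =
        fun _ => Matrix.of fun (_ : Fin 1) (j : Fin r) => if j = 0 then (1 : ℂ) else 0 :=
      funext fourierSeries_rowE1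
    rw [h1, h2]
    exact hyU
  have hV : ∀ j ≤ m + 1, V j (y * U) = V j (rowE1 d r) := fun j hj => (hrow.mono hj).V_eq
  have hVU : ∀ j ≤ m + 1, ∀ w : Filt d r 1, U * w ∈ V j y ↔ w ∈ V j (rowE1 d r) := by
    intro j hj w
    rw [mul_mem_V_iff, hV j hj]
  have hMU : ∀ μ : Fin d → ℕ, deg μ ≤ m →
      ∀ w : Filt d r 1, U * w ∈ M y μ ↔ w ∈ M (rowE1 d r) μ := by
    intro μ hμ w
    rw [mul_mem_M_iff, hrow.M_eq (Nat.lt_succ_iff.2 hμ)]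
  refine ⟨a', fun ξ => ?_, fun φ hφ => ?_, ?_, fun j hj => ⟨?_, ?_⟩, fun μ hμ => ⟨?_, ?_, ?_⟩,
    fun j _ w' _ n => ⟨?_, ?_, ?_⟩, fun p hp => ⟨fun j hj => ⟨?_, ?_⟩, ?_, ?_⟩, ?_, ?_⟩
  · rw [fourierSeries_inv hUW, fourierSeries_mul, fourierSeries_mul, fourierSeries_upsample]
  · exact hc.exists_refinable (hrow.fourierSeries_zero_eq (Nat.succ_pos m)) hφ
  · exact (hc.sumRules hlam0 hy).congr (Nat.succ_pos m) hrow
  · exact bijOn_mul hUW hWU (hVU j hj)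
  · convert generates_V hUW (hVU j hj) using 1
    simp only [generatorSet, Set.mem_ofPred_eq]
    congr 1
    ext w
    exact ⟨fun ⟨ν, hν, hw⟩ => ⟨_, ⟨ν, hν, rfl⟩, hw⟩, fun ⟨_, ⟨ν, hν, hc⟩, hw⟩ => ⟨ν, hν, hc ▸ hw⟩⟩
  · exact bijOn_mul hUW hWU (hMU μ hμ)
  · convert generates_M hUW (hMU μ hμ) using 1
    simp only [generatorSet, Set.mem_ofPred_eq]
    congr 1
    ext w
    exact ⟨fun ⟨ν, hν, hw⟩ => ⟨_, ⟨ν, hν, rfl⟩, hw⟩, fun ⟨_, ⟨ν, hν, hc⟩, hw⟩ => ⟨ν, hν, hc ▸ hw⟩⟩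
  · intro h
    convert generates_M_of_special hUW h (hMU μ hμ) using 1
    rw [generatorSet]
    congr 1
    ext w
    simp
  · exact hc.fourierSeries_iterFilter_mul n w'
  · exact hc.subdivIter_one_mul n w'
  · exact val_subdivIter_mul lam a' n U w'
  · exact fun w' _ => hc.growthRate_le hp w'
  · rw [hc.rhoAt_eq hp, rhoAt, rhoAt, hV j hj]
  · exact hc.rho_eq hlam0 hp
  · exact hc.sm_eq hlam0 hp
  -- Conjugation gives convergence with respect to `y * U` exactly; the congruence then exchanges
  -- this row for `rowE1`.
  · rw [hc.cmConvergentWith_iff hlam0]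
    exact ⟨fun h => h.congr hrow, fun h => h.congr hrow.symm⟩
  · exact hc.cmConvergent_iff hlam0
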